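/- Let $\Gamma = D^*_{x^2}$ be the group generated by $x_1,x_2,y_1,y_2,e,f$ subject to the relations that $e$ and $f$ are central, $[x_1,x_2]=[y_1,y_2]=1$, $[x_1,y_1]=[x_2,y_2]=e$, $[x_1,y_2]=f$, $[x_2,y_1]=1$ (the indecomposable $D^*$-group of Hirsch length $6$ attached to the primary polynomial $x^2$). For $n\ge 1$ let $a_n^\wedge(\Gamma)$ be the number of subgroups $\Delta\le\Gamma$ of index $n$ whose profinite completion $\widehat\Delta$ is isomorphic to $\widehat\Gamma$ (as a topological group); these numbers are finite. For a prime $p$ put $\zeta^\wedge_{\Gamma,p}(s)=\sum_{k\ge 0} a^\wedge_{p^k}(\Gamma)\,p^{-ks}$. Then for every prime $p$ and every $s\in\mathbb{C}$ with $\operatorname{Re}(s)>11/4$ the series converges absolutely and $$\zeta^\wedge_{\Gamma,p}(s)=\frac{1+p^{10-4s}}{(1-p^{8-3s})(1-p^{11-4s})(1-p^{12-5s})}.$$ In particular the local zeta functions satisfy the functional equation $$\zeta^\wedge_{\Gamma,p}(s)\big|_{p\to p^{-1}}=-\,p^{21-8s}\,\zeta^\wedge_{\Gamma,p}(s),$$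 in the following sense: there is a rational function $W(X,Y)\in\mathbb{Q}(X,Y)$ such that, for all primes $p$, $\zeta^\wedge_{\Gamma,p}(s)=W(p,p^{-s})$ as an identity of power series in $p^{-s}$, and $W(X^{-1},Y^{-1})=-X^{21}Y^{8}\,W(X,Y)$. -/

import Mathlib

open Polynomial
open scoped commutatorElement

/-- Entries of the companion matrix `K` of a monic polynomial `P = x ^ m - a₁ x ^ (m - 1) - ⋯ - aₘ` of
degree `m`: ones on the superdiagonal and last row `(aₘ, …, a₂, a₁)`. With rows and columns
numbered from `0`, the last row has `j`-th entry `-(coefficient of x ^ j in P)`. -/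
noncomputable def companionEntry (m : ℕ) (P : ℤ[X]) (i j : Fin m) : ℤ :=
  (if (i : ℕ) + 1 = j then 1 else 0) + (if (i : ℕ) + 1 = m then -P.coeff j else 0)

/-- Generators `x₁, …, xₘ, y₁, …, yₘ, e, f` of a `D^*`-group of Hirsch length `2 m + 2`. -/
inductive DStarGen (m : ℕ) : Type
  | x (i : Fin m) : DStarGen m
  | y (i : Fin m) : DStarGen m
  | e : DStarGen m
  | f : DStarGen m

open DStarGen FreeGroup in
/-- The defining relations of the `D^*`-group of a monic polynomial `P` of degree `m`:
`e` and `f` are central, the `xᵢ` commute with each other, the `yᵢ` commute with each other, and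
`[xᵢ, yⱼ] = e ^ δᵢⱼ f ^ Kᵢⱼ` where `K` is the companion matrix of `P`. -/
inductive DStarRel (m : ℕ) (P : ℤ[X]) : FreeGroup (DStarGen m) → Prop
  | e_central (g : DStarGen m) : DStarRel m P ⁅of (e : DStarGen m), of g⁆
  | f_central (g : DStarGen m) : DStarRel m P ⁅of (f : DStarGen m), of g⁆
  | x_comm (i j : Fin m) : DStarRel m P ⁅of (x i), of (x j)⁆
  | y_comm (i j : Fin m) : DStarRel m P ⁅of (y i), of (y j)⁆
  | xy_comm (i j : Fin m) : DStarRel m P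
      (⁅of (x i), of (y j)⁆ *
        (of e ^ (if i = j then (1 : ℤ) else 0) * of f ^ companionEntry m P i j)⁻¹)

/-- The `D^*`-group (of even Hirsch length `2 m + 2`) of a monic polynomial `P` of degree `m`. -/
abbrev DStarGroup (m : ℕ) (P : ℤ[X]) : Type :=
  PresentedGroup {r : FreeGroup (DStarGen m) | DStarRel m P r}

/-- The subgroups of index `n` in `G` whose profinite completion is isomorphic, as a topological
group, to the profinite completion of `G`. -/
def proisomorphicSubgroups (G : Type) [Group G] (n : ℕ) : Set (Subgroup G) :=
  {H | H.index = n ∧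
    Nonempty (ProfiniteGrp.ProfiniteCompletion.completion (GrpCat.of H) ≃ₜ*
      ProfiniteGrp.ProfiniteCompletion.completion (GrpCat.of G))}

/-- The number of subgroups counted by the pro-isomorphic zeta function at `n`. -/
noncomputable def proisomorphicCount (G : Type) [Group G] (n : ℕ) : ℕ :=
  (proisomorphicSubgroups G n).ncard

/-- The local pro-isomorphic zeta function of `G` at `p`. -/
noncomputable def localProisomorphicZeta (G : Type) [Group G] (p : ℕ) (s : ℂ) : ℂ :=
  ∑' k : ℕ, (proisomorphicCount G (p ^ k) : ℂ) * (p : ℂ) ^ (-((k : ℂ) * s))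

/-- The local pro-isomorphic zeta functions of `G` are, for all primes `p`, given by a single
rational function `W(X, Y) = N(X, Y) / D(X, Y)` over `ℚ` at `X = p`, `Y = p ^ (-s)`, as an identity
of power series in `Y` over `ℚ`, and
`W(X⁻¹, Y⁻¹) = (-1) ^ a X ^ b Y ^ c W(X, Y)`. In other words
`ζ_p(s)|_{p → p⁻¹} = (-1) ^ a p ^ (b - c s) ζ_p(s)`. -/
def ProisomorphicFunctionalEquation (G : Type) [Group G] (a b c : ℤ) : Prop :=
  ∃ N D : MvPolynomial (Fin 2) ℚ,
    (∀ p : ℕ, p.Prime →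
      MvPolynomial.aeval ![PowerSeries.C (p : ℚ), (PowerSeries.X : PowerSeries ℚ)] D ≠ 0 ∧
      MvPolynomial.aeval ![PowerSeries.C (p : ℚ), PowerSeries.X] D *
          PowerSeries.mk (fun k => (proisomorphicCount G (p ^ k) : ℚ)) =
        MvPolynomial.aeval ![PowerSeries.C (p : ℚ), PowerSeries.X] N) ∧
    let X : FractionRing (MvPolynomial (Fin 2) ℚ) :=
      algebraMap _ _ (MvPolynomial.X 0 : MvPolynomial (Fin 2) ℚ)
    let Y : FractionRing (MvPolynomial (Fin 2) ℚ) :=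
      algebraMap _ _ (MvPolynomial.X 1 : MvPolynomial (Fin 2) ℚ)
    MvPolynomial.aeval ![X⁻¹, Y⁻¹] N / MvPolynomial.aeval ![X⁻¹, Y⁻¹] D =
      (-1) ^ a * X ^ b * Y ^ c *
        (MvPolynomial.aeval ![X, Y] N / MvPolynomial.aeval ![X, Y] D)

/-! The group is the Heisenberg group over `ℤ[ε]` with `ε² = 0`: take `x₁ = 1`, `x₂ = ε` in the
`a`-entry, `y₂ = 1`, `y₁ = ε` in the `b`-entry and `f = 1`, `e = ε` in the `c`-entry, so that `[x₂,
y₁] = ε² = 0`. A subgroup `D` has three layers: the lattice `L₁` of the vectors `(a0, b0)`, the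
lattice `L₀` of the vectors `(a1, b1)` of those elements with `a0 = b0 = 0`, and its intersection
with the centre.

The heart of the proof is that `D` of index `p ^ k` is counted exactly when `L₁ = p ^ i L` and `L₀ =
p ^ l L` for a common lattice `L` of index `p ^ m` with cyclic quotient, and `D` meets the centre
only in its commutators (`Heis.proisomorphicSubgroups_eq`). If this holds, lifts of a basis of `L`
at both levels satisfy the defining relations and generate `D`, so `D` is even isomorphic to the
whole group. Conversely, an isomorphism of completions turns the inclusion of `D` into the `p`-adic
Heisenberg group into a homomorphism `τ` from the whole group whose image has the same closure. The
relations between the `τ`-images of the generators force `x₂` and `y₁` into the `ε`-layer and make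
their vectors a common `p`-adic multiple of those of `x₁` and `y₂`. Since `D` contains all elements
whose coordinates are divisible by `p ^ k`, these `p`-adic statements descend to `D`.

For the count, subgroups with prescribed image and prescribed intersection with a central subgroup
form a torsor under a group of homomorphisms (`card_subgroup_fiber`). Applied to the two extensions,
this gives `p ^ (12 i + 8 l + 10 m)` subgroups of index `p ^ (5 i + 3 l + 4 m)` for each `L`. There
are `p ^ m + p ^ (m - 1)` lattices `L` if `m > 0`, and one if `m = 0`. Summing three geometric
series gives the rational function. -/

/-- The Heisenberg group over the dual numbers `A[ε]`: the triple `(a, b, c)` with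
`a = a0 + a1 ε`, `b = b0 + b1 ε`, `c = c0 + c1 ε`, and
`(a, b, c) * (a', b', c') = (a + a', b + b', c + c' + a * b')`. -/
@[ext]
structure Heis (A : Type*) where
  a0 : A
  a1 : A
  b0 : A
  b1 : A
  c0 : A
  c1 : A

/-! ### The Heisenberg group over the dual numbers -/

namespace Heis

section Basic

variable {A : Type*} [CommRing A]

instance : Mul (Heis A) :=
  ⟨fun g h => ⟨g.a0 + h.a0, g.a1 + h.a1, g.b0 + h.b0, g.b1 + h.b1, g.c0 + h.c0 + g.a0 * h.b0,
    g.c1 + h.c1 + g.a0 * h.b1 + g.a1 * h.b0⟩⟩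

instance : One (Heis A) := ⟨⟨0, 0, 0, 0, 0, 0⟩⟩

instance : Inv (Heis A) :=
  ⟨fun g => ⟨-g.a0, -g.a1, -g.b0, -g.b1, -g.c0 + g.a0 * g.b0,
    -g.c1 + g.a0 * g.b1 + g.a1 * g.b0⟩⟩

@[simp] theorem mul_a0 (g h : Heis A) : (g * h).a0 = g.a0 + h.a0 := rfl
@[simp] theorem mul_a1 (g h : Heis A) : (g * h).a1 = g.a1 + h.a1 := rfl
@[simp] theorem mul_b0 (g h : Heis A) : (g * h).b0 = g.b0 + h.b0 := rfl
@[simp] theorem mul_b1 (g h : Heis A) : (g * h).b1 = g.b1 + h.b1 := rfl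
@[simp] theorem mul_c0 (g h : Heis A) : (g * h).c0 = g.c0 + h.c0 + g.a0 * h.b0 := rfl
@[simp] theorem mul_c1 (g h : Heis A) :
    (g * h).c1 = g.c1 + h.c1 + g.a0 * h.b1 + g.a1 * h.b0 := rfl
@[simp] theorem one_a0 : (1 : Heis A).a0 = 0 := rfl
@[simp] theorem one_a1 : (1 : Heis A).a1 = 0 := rfl
@[simp] theorem one_b0 : (1 : Heis A).b0 = 0 := rfl
@[simp] theorem one_b1 : (1 : Heis A).b1 = 0 := rfl
@[simp] theorem one_c0 : (1 : Heis A).c0 = 0 := rfl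
@[simp] theorem one_c1 : (1 : Heis A).c1 = 0 := rfl
@[simp] theorem inv_a0 (g : Heis A) : g⁻¹.a0 = -g.a0 := rfl
@[simp] theorem inv_a1 (g : Heis A) : g⁻¹.a1 = -g.a1 := rfl
@[simp] theorem inv_b0 (g : Heis A) : g⁻¹.b0 = -g.b0 := rfl
@[simp] theorem inv_b1 (g : Heis A) : g⁻¹.b1 = -g.b1 := rfl
@[simp] theorem inv_c0 (g : Heis A) : g⁻¹.c0 = -g.c0 + g.a0 * g.b0 := rfl
@[simp] theorem inv_c1 (g : Heis A) : g⁻¹.c1 = -g.c1 + g.a0 * g.b1 + g.a1 * g.b0 := rfl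

instance : Group (Heis A) :=
  Group.ofLeftAxioms (by intros; ext <;> simp <;> ring) (by intros; ext <;> simp)
    (by intros; ext <;> (simp; try ring))

/-- The map of Heisenberg groups induced by a ring homomorphism. -/
def map {B : Type*} [CommRing B] (φ : A →+* B) : Heis A →* Heis B where
  toFun g := ⟨φ g.a0, φ g.a1, φ g.b0, φ g.b1, φ g.c0, φ g.c1⟩
  map_one' := by ext <;> simp
  map_mul' g h := by ext <;> simp

@[simp] theorem map_a0 {B : Type*} [CommRing B] (φ : A →+* B) (g : Heis A) :
    (map φ g).a0 = φ g.a0 := rfl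
@[simp] theorem map_a1 {B : Type*} [CommRing B] (φ : A →+* B) (g : Heis A) :
    (map φ g).a1 = φ g.a1 := rfl
@[simp] theorem map_b0 {B : Type*} [CommRing B] (φ : A →+* B) (g : Heis A) :
    (map φ g).b0 = φ g.b0 := rfl
@[simp] theorem map_b1 {B : Type*} [CommRing B] (φ : A →+* B) (g : Heis A) :
    (map φ g).b1 = φ g.b1 := rfl
@[simp] theorem map_c0 {B : Type*} [CommRing B] (φ : A →+* B) (g : Heis A) :
    (map φ g).c0 = φ g.c0 := rfl
@[simp] theorem map_c1 {B : Type*} [CommRing B] (φ : A →+* B) (g : Heis A) :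
    (map φ g).c1 = φ g.c1 := rfl

/-- The formal power `g ^ n`, where `q` stands for the binomial coefficient `n.choose 2`. -/
def formalPow (g : Heis A) (n q : A) : Heis A :=
  ⟨n * g.a0, n * g.a1, n * g.b0, n * g.b1, n * g.c0 + q * (g.a0 * g.b0),
    n * g.c1 + q * (g.a0 * g.b1 + g.a1 * g.b0)⟩

/-- The binomial coefficient enters only through `2 * q = n * (n - 1)`. This is a closed condition
that needs no division by `2`, so it survives passage to `p`-adic limits, also for `p = 2`. -/
theorem exists_zpow_eq_formalPow (n : ℤ) :
    ∃ q : ℤ, 2 * q = n * (n - 1) ∧ ∀ g : Heis A, g ^ n = g.formalPow n q := by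
  induction n using Int.induction_on with
  | zero => exact ⟨0, by simp, fun g => by ext <;> simp [formalPow]⟩
  | succ k ih =>
    obtain ⟨q, hq, h⟩ := ih
    refine ⟨q + k, by linear_combination hq, fun g => ?_⟩
    rw [zpow_add_one, h]
    ext <;> simp [formalPow] <;> ring
  | pred k ih =>
    obtain ⟨q, hq, h⟩ := ih
    refine ⟨q + k + 1, by linear_combination hq, fun g => ?_⟩
    rw [zpow_sub_one, h]
    ext <;> simp [formalPow] <;> ring

end Basic

/-! ### Universal property of the integral Heisenberg group -/

section Lift

variable {G : Type*} [Group G]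

/-- Conjugating `y ^ n` by `x` multiplies it by the central `z ^ n`; hence conjugating `x` by `y ^
n` multiplies it by `z ^ n` as well, up to the choice of side, and an `m`-th power gives the
exponent `m * n`. -/
theorem zpow_mul_zpow_of_mul_eq {x y z : G} (hz : ∀ g, Commute z g) (h : x * y = y * x * z)
    (m n : ℤ) : x ^ m * y ^ n = y ^ n * x ^ m * z ^ (m * n) := by
  have h1 : x * y ^ n * x⁻¹ = y ^ n * z ^ n := by
    rw [← conj_zpow, h, mul_assoc, (hz x⁻¹).eq, ← (hz y).symm.mul_zpow n]
    congr 1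
    group
  have h2 : (y ^ n)⁻¹ * x * y ^ n = x * z ^ n := by
    have h3 : x * y ^ n = y ^ n * z ^ n * x := by rw [← h1]; group
    rw [mul_assoc, h3, ← ((hz x).zpow_left n).eq]
    group
  have h3 : (y ^ n)⁻¹ * x ^ m * y ^ n = x ^ m * z ^ (m * n) := by
    have h4 := conj_zpow (i := m) (a := (y ^ n)⁻¹) (b := x)
    rw [inv_inv, h2, ((hz x).symm.zpow_right n).mul_zpow, ← zpow_mul, mul_comm n m] at h4
    exact h4.symm
  rw [mul_assoc, ← h3]
  group

/-- Elements of a group that satisfy the defining relations of the Heisenberg group over the dual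
numbers of `ℤ`. -/
structure Relations (X₁ X₂ Y₁ Y₂ E F : G) : Prop where
  e_central : ∀ g, Commute E g
  f_central : ∀ g, Commute F g
  xx : Commute X₁ X₂
  yy : Commute Y₁ Y₂
  x₂y₁ : Commute X₂ Y₁
  x₁y₁ : X₁ * Y₁ = Y₁ * X₁ * E
  x₂y₂ : X₂ * Y₂ = Y₂ * X₂ * E
  x₁y₂ : X₁ * Y₂ = Y₂ * X₁ * F

variable {X₁ X₂ Y₁ Y₂ E F : G}

/-- The homomorphism from the Heisenberg group over the dual numbers of `ℤ` that is determined by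
elements satisfying its defining relations. -/
def lift (h : Relations X₁ X₂ Y₁ Y₂ E F) : Heis ℤ →* G :=
  -- The `Y`-part stands on the left because the cocycle `a * b'` pairs the `a`-entry of the left
  -- factor with the `b`-entry of the right one: in this order the coordinates are the exponents,
  -- without correction.
  MonoidHom.mk' (fun g => Y₂ ^ g.b0 * Y₁ ^ g.b1 * (X₁ ^ g.a0 * X₂ ^ g.a1) * (F ^ g.c0 * E ^ g.c1))
  (by
    intro g k
    have hY : Y₂ ^ (g.b0 + k.b0) * Y₁ ^ (g.b1 + k.b1) =
        Y₂ ^ g.b0 * Y₁ ^ g.b1 * (Y₂ ^ k.b0 * Y₁ ^ k.b1) := by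
      rw [zpow_add, zpow_add, (h.yy.symm.zpow_zpow _ _).mul_mul_mul_comm]
    have hX : X₁ ^ (g.a0 + k.a0) * X₂ ^ (g.a1 + k.a1) =
        X₁ ^ g.a0 * X₂ ^ g.a1 * (X₁ ^ k.a0 * X₂ ^ k.a1) := by
      rw [zpow_add, zpow_add, (h.xx.zpow_zpow _ _).mul_mul_mul_comm]
    have hZ (i j : ℤ) (x : G) : Commute (F ^ i * E ^ j) x :=
      ((h.f_central x).zpow_left i).mul_left ((h.e_central x).zpow_left j)
    have hF : F ^ (g.c0 + k.c0 + g.a0 * k.b0) *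
        E ^ (g.c1 + k.c1 + g.a0 * k.b1 + g.a1 * k.b0) =
        F ^ (g.a0 * k.b0) * E ^ (g.a0 * k.b1 + g.a1 * k.b0) * (F ^ g.c0 * E ^ g.c1) *
          (F ^ k.c0 * E ^ k.c1) := by
      have hadd (i j i' j' : ℤ) : F ^ i * E ^ j * (F ^ i' * E ^ j') =
          F ^ (i + i') * E ^ (j + j') := by
        rw [((h.e_central _).zpow_left _).mul_mul_mul_comm, ← zpow_add, ← zpow_add]
      rw [hadd, hadd]
      congr 2 <;> ring
    -- The only reordering that is not free: moving the `X`-part of `g` past the `Y`-part of `k`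
    -- produces exactly the cocycle.
    have hW : X₁ ^ g.a0 * X₂ ^ g.a1 * (Y₂ ^ k.b0 * Y₁ ^ k.b1) =
        Y₂ ^ k.b0 * Y₁ ^ k.b1 * (X₁ ^ g.a0 * X₂ ^ g.a1) *
          (F ^ (g.a0 * k.b0) * E ^ (g.a0 * k.b1 + g.a1 * k.b0)) := by
      have e1 := zpow_mul_zpow_of_mul_eq h.f_central h.x₁y₂ g.a0 k.b0
      have e2 := zpow_mul_zpow_of_mul_eq h.e_central h.x₁y₁ g.a0 k.b1
      have e3 := zpow_mul_zpow_of_mul_eq h.e_central h.x₂y₂ g.a1 k.b0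
      have e4 := (h.x₂y₁.zpow_zpow g.a1 k.b1).eq
      have c1 (i : ℤ) (x : G) := ((h.e_central x).zpow_left i).eq
      have c2 (i : ℤ) (x : G) := ((h.f_central x).zpow_left i).eq
      calc X₁ ^ g.a0 * X₂ ^ g.a1 * (Y₂ ^ k.b0 * Y₁ ^ k.b1)
          = X₁ ^ g.a0 * (X₂ ^ g.a1 * Y₂ ^ k.b0) * Y₁ ^ k.b1 := by group
        _ = X₁ ^ g.a0 * Y₂ ^ k.b0 * (X₂ ^ g.a1 * (E ^ (g.a1 * k.b0) * Y₁ ^ k.b1)) := by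
          rw [e3]; simp only [mul_assoc]
        _ = Y₂ ^ k.b0 * X₁ ^ g.a0 * (F ^ (g.a0 * k.b0) * (Y₁ ^ k.b1 * X₂ ^ g.a1)) *
            E ^ (g.a1 * k.b0) := by
          rw [e1, c1, ← mul_assoc (X₂ ^ g.a1), e4]; simp only [mul_assoc]
        _ = Y₂ ^ k.b0 * (X₁ ^ g.a0 * Y₁ ^ k.b1) * X₂ ^ g.a1 * F ^ (g.a0 * k.b0) *
            E ^ (g.a1 * k.b0) := by
          rw [c2]; simp only [mul_assoc]
        _ = Y₂ ^ k.b0 * Y₁ ^ k.b1 * X₁ ^ g.a0 * (E ^ (g.a0 * k.b1) *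
            (X₂ ^ g.a1 * F ^ (g.a0 * k.b0))) * E ^ (g.a1 * k.b0) := by
          rw [e2]; simp only [mul_assoc]
        _ = _ := by
          rw [c1, zpow_add]; simp only [mul_assoc]
    simp only [mul_a0, mul_a1, mul_b0, mul_b1, mul_c0, mul_c1]
    rw [hY, hX, hF]
    calc _ = Y₂ ^ g.b0 * Y₁ ^ g.b1 * (Y₂ ^ k.b0 * Y₁ ^ k.b1 * (X₁ ^ g.a0 * X₂ ^ g.a1) *
          ((X₁ ^ k.a0 * X₂ ^ k.a1) * ((F ^ (g.a0 * k.b0) * E ^ (g.a0 * k.b1 + g.a1 * k.b0)) *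
          (F ^ g.c0 * E ^ g.c1)))) * (F ^ k.c0 * E ^ k.c1) := by simp only [mul_assoc]
      _ = Y₂ ^ g.b0 * Y₁ ^ g.b1 * (Y₂ ^ k.b0 * Y₁ ^ k.b1 * (X₁ ^ g.a0 * X₂ ^ g.a1) *
          (F ^ (g.a0 * k.b0) * E ^ (g.a0 * k.b1 + g.a1 * k.b0))) * ((F ^ g.c0 * E ^ g.c1) *
          (X₁ ^ k.a0 * X₂ ^ k.a1)) * (F ^ k.c0 * E ^ k.c1) := by
        rw [← mul_assoc (X₁ ^ k.a0 * X₂ ^ k.a1), ← (hZ _ _ (X₁ ^ k.a0 * X₂ ^ k.a1)).eq,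
          mul_assoc (F ^ (g.a0 * k.b0) * E ^ (g.a0 * k.b1 + g.a1 * k.b0)),
          ← (hZ g.c0 g.c1 (X₁ ^ k.a0 * X₂ ^ k.a1)).eq]
        simp only [mul_assoc]
      _ = _ := by
        have hc := congrArg (Y₂ ^ g.b0 * Y₁ ^ g.b1 * (X₁ ^ g.a0 * X₂ ^ g.a1) * · *
          (X₁ ^ k.a0 * X₂ ^ k.a1 * (F ^ k.c0 * E ^ k.c1)))
          (hZ g.c0 g.c1 (Y₂ ^ k.b0 * Y₁ ^ k.b1)).eq.symm
        rw [← hW]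
        simp only [mul_assoc] at hc ⊢
        exact hc)

theorem lift_apply (h : Relations X₁ X₂ Y₁ Y₂ E F) (g : Heis ℤ) :
    lift h g =
      Y₂ ^ g.b0 * Y₁ ^ g.b1 * (X₁ ^ g.a0 * X₂ ^ g.a1) * (F ^ g.c0 * E ^ g.c1) := rfl

end Lift

section Generators

variable (A : Type*) [CommRing A]

def x₁ : Heis A := ⟨1, 0, 0, 0, 0, 0⟩
def x₂ : Heis A := ⟨0, 1, 0, 0, 0, 0⟩
def y₂ : Heis A := ⟨0, 0, 1, 0, 0, 0⟩
def y₁ : Heis A := ⟨0, 0, 0, 1, 0, 0⟩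
def f : Heis A := ⟨0, 0, 0, 0, 1, 0⟩
def e : Heis A := ⟨0, 0, 0, 0, 0, 1⟩

variable {A}

theorem eq_mul_zpow (g : Heis ℤ) :
    g = y₂ ℤ ^ g.b0 * y₁ ℤ ^ g.b1 * (x₁ ℤ ^ g.a0 * x₂ ℤ ^ g.a1) * (f ℤ ^ g.c0 * e ℤ ^ g.c1) := by
  obtain ⟨q1, -, h1⟩ := exists_zpow_eq_formalPow (A := ℤ) g.b0
  obtain ⟨q2, -, h2⟩ := exists_zpow_eq_formalPow (A := ℤ) g.b1
  obtain ⟨q3, -, h3⟩ := exists_zpow_eq_formalPow (A := ℤ) g.a0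
  obtain ⟨q4, -, h4⟩ := exists_zpow_eq_formalPow (A := ℤ) g.a1
  obtain ⟨q5, -, h5⟩ := exists_zpow_eq_formalPow (A := ℤ) g.c0
  obtain ⟨q6, -, h6⟩ := exists_zpow_eq_formalPow (A := ℤ) g.c1
  rw [h1, h2, h3, h4, h5, h6]
  ext <;> simp [formalPow, x₁, x₂, y₁, y₂, f, e]

theorem relations_generators :
    Relations (x₁ A) (x₂ A) (y₁ A) (y₂ A) (e A) (f A) := by
  constructor <;> intros <;> (try refine Heis.ext ?_ ?_ ?_ ?_ ?_ ?_) <;>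
    simp [x₁, x₂, y₁, y₂, e, f, add_comm]

end Generators

/-! ### Identification with the presented group -/

section Presentation

/-- The images in the Heisenberg group of the generators of the `D^*`-group of `x ^ 2`. -/
def ofGen : DStarGen 2 → Heis ℤ
  | .x i => if i = 0 then x₁ ℤ else x₂ ℤ
  | .y i => if i = 0 then y₁ ℤ else y₂ ℤ
  | .e => e ℤ
  | .f => f ℤ

theorem companionEntry_X_sq (i j : Fin 2) :
    companionEntry 2 (X ^ 2) i j = if i = 0 ∧ j = 1 then 1 else 0 := by
  fin_cases i <;> fin_cases j <;> simp [companionEntry, coeff_X_pow]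

theorem lift_ofGen_eq_one (r : FreeGroup (DStarGen 2)) (hr : DStarRel 2 (X ^ 2) r) :
    FreeGroup.lift ofGen r = 1 := by
  have hrel := relations_generators (A := ℤ)
  cases hr with
  | e_central g =>
    simpa [ofGen, commutatorElement_eq_one_iff_commute] using hrel.e_central _
  | f_central g =>
    simpa [ofGen, commutatorElement_eq_one_iff_commute] using hrel.f_central _
  | x_comm i j =>
    fin_cases i <;> fin_cases j <;>
      simp [ofGen, commutatorElement_eq_one_iff_commute, hrel.xx, hrel.xx.symm]
  | y_comm i j =>
    fin_cases i <;> fin_cases j <;>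
      simp [ofGen, commutatorElement_eq_one_iff_commute, hrel.yy, hrel.yy.symm]
  | xy_comm i j =>
    rw [companionEntry_X_sq]
    fin_cases i <;> fin_cases j <;>
      ext <;> simp [ofGen, commutatorElement_def, x₁, x₂, y₁, y₂, e, f]

theorem dStarGroup_relations :
    Relations (G := DStarGroup 2 (X ^ 2)) (PresentedGroup.of (.x 0)) (PresentedGroup.of (.x 1))
      (PresentedGroup.of (.y 0)) (PresentedGroup.of (.y 1)) (PresentedGroup.of .e)
      (PresentedGroup.of .f) := by
  have key (r) (hr : DStarRel 2 (X ^ 2) r) :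
      PresentedGroup.mk {r : FreeGroup (DStarGen 2) | DStarRel 2 (X ^ 2) r} r = 1 :=
    PresentedGroup.one_of_mem hr
  -- The relations give commutation with generators only; the centralizer of `z` contains them,
  -- hence is everything.
  have central (z : DStarGen 2)
      (hz : ∀ g, DStarRel 2 (X ^ 2) ⁅FreeGroup.of z, FreeGroup.of g⁆)
      (g : DStarGroup 2 (X ^ 2)) : Commute (PresentedGroup.of z) g := by
    have hg : g ∈ Subgroup.centralizer {(PresentedGroup.of z : DStarGroup 2 (X ^ 2))} := by
      have : (⊤ : Subgroup (DStarGroup 2 (X ^ 2))) ≤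
          Subgroup.centralizer {PresentedGroup.of z} := by
        rw [← PresentedGroup.closure_range_of, Subgroup.closure_le]
        rintro _ ⟨y, rfl⟩
        have := key _ (hz y)
        rw [map_commutatorElement, commutatorElement_eq_one_iff_commute] at this
        exact Subgroup.mem_centralizer_singleton_iff.2 this.symm.eq
      exact this trivial
    exact (Subgroup.mem_centralizer_singleton_iff.1 hg).symm
  have comm (i j : DStarGen 2) (h : DStarRel 2 (X ^ 2) ⁅FreeGroup.of i, FreeGroup.of j⁆) :
      Commute (PresentedGroup.of i : DStarGroup 2 (X ^ 2)) (PresentedGroup.of j) := by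
    have := key _ h
    rwa [map_commutatorElement, commutatorElement_eq_one_iff_commute] at this
  have he := central .e DStarRel.e_central
  have hf := central .f DStarRel.f_central
  have xy (i j : Fin 2) := key _ (DStarRel.xy_comm i j)
  simp only [map_mul, map_commutatorElement, map_inv, mul_inv_eq_one, map_zpow,
    companionEntry_X_sq] at xy
  have tr {a b z : DStarGroup 2 (X ^ 2)} (h : ⁅a, b⁆ = z) (hz : ∀ g, Commute z g) :
      a * b = b * a * z := by
    rw [← (hz _).eq, ← h, commutatorElement_def]; group
  refine ⟨he, hf, comm _ _ (.x_comm _ _), comm _ _ (.y_comm _ _), ?_, tr ?_ he, tr ?_ he, tr ?_ hf⟩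
  · have := xy 1 0
    simp at this
    exact commutatorElement_eq_one_iff_commute.1 this
  · have := xy 0 0
    simp at this
    exact this
  · have := xy 1 1
    simp at this
    exact this
  · have := xy 0 1
    simp at this
    exact this

/-- The `D^*`-group of `x ^ 2` is the Heisenberg group over the dual numbers of `ℤ`. -/
noncomputable def equivDStarGroup : DStarGroup 2 (X ^ 2) ≃* Heis ℤ :=
  MonoidHom.toMulEquiv (PresentedGroup.toGroup (f := ofGen) lift_ofGen_eq_one)
    (lift dStarGroup_relations)
    (by
      ext g
      rcases g with i | i | _ | _
      · fin_cases i <;> simp [ofGen, lift_apply, x₁, x₂]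
      · fin_cases i <;> simp [ofGen, lift_apply, y₁, y₂]
      · simp [ofGen, lift_apply, e]
      · simp [ofGen, lift_apply, f])
    (by
      refine MonoidHom.ext fun g => ?_
      rw [MonoidHom.comp_apply, MonoidHom.id_apply, lift_apply]
      conv_rhs => rw [eq_mul_zpow g]
      simp [ofGen])

end Presentation
end Heis

/-! ### Counting subgroups of a central extension -/

section Fiber

theorem card_monoidHom_of_free {M A : Type*} [Group M] [CommGroup A] {r : ℕ}
    (e : M ≃* Multiplicative (Fin r → ℤ)) : Nat.card (M →* A) = Nat.card A ^ r := by
  have e1 : (M →* A) ≃ (Multiplicative (Fin r → ℤ) →* A) :=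
    { toFun := fun χ => χ.comp e.symm.toMonoidHom
      invFun := fun χ => χ.comp e.toMonoidHom
      left_inv := fun χ => by ext; simp
      right_inv := fun χ => by ext; simp }
  have e2 : ((Fin r → ℤ) →+ Additive A) ≃ (Multiplicative (Fin r → ℤ) →* A) :=
    AddMonoidHom.toMultiplicativeLeft
  have e3 : ((Fin r → ℤ) →ₗ[ℤ] Additive A) ≃ ((Fin r → ℤ) →+ Additive A) :=
    (addMonoidHomLequivInt ℤ).symm.toEquiv
  have e4 : (Fin r → Additive A) ≃ ((Fin r → ℤ) →ₗ[ℤ] Additive A) :=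
    ((Pi.basisFun ℤ (Fin r)).constr ℤ).toEquiv
  rw [Nat.card_congr (e1.trans (e2.symm.trans (e3.symm.trans e4.symm))), Nat.card_pi,
    Finset.prod_const,
    Finset.card_univ, Fintype.card_fin]
  exact congrArg (· ^ r) (Nat.card_congr Additive.toMul)

variable {G Q C : Type*} [Group G] [Group Q] [CommGroup C] {κ : C →* G} {f : G →* Q}

/-- The subgroup obtained from `D` by multiplying its elements by central elements according to
a homomorphism on its image modulo the centre. -/
def Subgroup.twist (D : Subgroup G) (hκ : ∀ c g, Commute (κ c) g)
    (χ : D.map f →* C ⧸ D.comap κ) : Subgroup G where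
  carrier := {g | ∃ d, ∃ hd : d ∈ D, ∃ c, g = d * κ c ∧ χ ⟨f d, mem_map_of_mem f hd⟩ = (c : C ⧸ _)}
  one_mem' := ⟨1, D.one_mem, 1, by simp, by
    rw [QuotientGroup.mk_one, ← map_one χ]; congr 1; ext; simp⟩
  mul_mem' := by
    rintro _ _ ⟨d, hd, c, rfl, h⟩ ⟨d', hd', c', rfl, h'⟩
    refine ⟨d * d', D.mul_mem hd hd', c * c', ?_, ?_⟩
    · rw [(hκ c _).mul_mul_mul_comm, map_mul]
    · rw [QuotientGroup.mk_mul, ← h, ← h', ← map_mul]; congr 1; ext; simp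
  inv_mem' := by
    rintro _ ⟨d, hd, c, rfl, h⟩
    refine ⟨d⁻¹, D.inv_mem hd, c⁻¹, ?_, ?_⟩
    · rw [mul_inv_rev, ← map_inv, (hκ _ _).eq]
    · rw [QuotientGroup.mk_inv, ← h, ← map_inv]; congr 1; ext; simp

/-- These subgroups form a torsor under the homomorphisms from `D.map f` to `C ⧸ D.comap κ`: `D'`
corresponds to the map sending `f d` to the class of any `c` with `d * κ c ∈ D'`, and `D` itself to
the trivial one. As the source is free abelian of rank `r`, there are `index ^ r` of them. -/
theorem card_subgroup_fiber (hinj : Function.Injective κ) (hκ : ∀ c g, Commute (κ c) g)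
    (hf : f.ker = κ.range) (D : Subgroup G) {r : ℕ} (e : D.map f ≃* Multiplicative (Fin r → ℤ)) :
    Nat.card {D' : Subgroup G // D'.map f = D.map f ∧ D'.comap κ = D.comap κ} =
      (D.comap κ).index ^ r := by
  have hfκ (c : C) : f (κ c) = 1 := by
    have : κ c ∈ f.ker := hf ▸ ⟨c, rfl⟩
    exact this
  have ex {g g' : G} (h : f g = f g') : ∃ c, g' = g * κ c := by
    have : g⁻¹ * g' ∈ κ.range := hf ▸ (by simp [MonoidHom.mem_ker, h])
    obtain ⟨c, hc⟩ := this
    exact ⟨c, by rw [hc]; group⟩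
  -- The class of `c` depends only on `f d`: two choices differ by an element of `D' ∩ κ(C) = D ∩
  -- κ(C)`.
  have uniq {D' : Subgroup G} (hD' : D'.comap κ = D.comap κ) {d d' : G} (hd : d ∈ D)
      (hd' : d' ∈ D) (h : f d = f d') {c c' : C} (hc : d * κ c ∈ D') (hc' : d' * κ c' ∈ D') :
      (c : C ⧸ D.comap κ) = c' := by
    obtain ⟨b, rfl⟩ := ex h
    have hb : b ∈ D.comap κ := by simpa using D.mul_mem (D.inv_mem hd) hd'
    have : c⁻¹ * (b * c') ∈ D'.comap κ := by
      rw [Subgroup.mem_comap]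
      convert D'.mul_mem (D'.inv_mem hc) hc' using 1
      simp only [map_mul, map_inv]; group
    rw [hD'] at this
    rw [QuotientGroup.eq]
    have h2 := Subgroup.mul_mem _ this (Subgroup.inv_mem _ hb)
    have h3 : c⁻¹ * (b * c') * b⁻¹ = c⁻¹ * c' := by
      rw [mul_comm b c', ← mul_assoc, mul_inv_cancel_right]
    rwa [h3] at h2
  rw [Subgroup.index, ← card_monoidHom_of_free (A := C ⧸ D.comap κ) e]
  symm
  refine Nat.card_eq_of_bijective (fun χ => ⟨D.twist hκ χ, ?_, ?_⟩) ⟨?_, ?_⟩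
  · ext q
    constructor
    · rintro ⟨_, ⟨d, hd, c, rfl, -⟩, rfl⟩
      exact ⟨d, hd, by simp [hfκ]⟩
    · rintro ⟨d, hd, rfl⟩
      obtain ⟨c, hc⟩ := QuotientGroup.mk_surjective (χ ⟨f d, Subgroup.mem_map_of_mem f hd⟩)
      exact ⟨d * κ c, ⟨d, hd, c, rfl, hc.symm⟩, by simp [hfκ]⟩
  · ext c
    rw [Subgroup.mem_comap, Subgroup.mem_comap]
    constructor
    · rintro ⟨d, hd, c', h, h'⟩
      have hfd : f d = 1 := by simpa [hfκ] using (congrArg f h).symm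
      have : χ ⟨f d, Subgroup.mem_map_of_mem f hd⟩ = 1 := by
        rw [← map_one χ]; congr 1; ext; simpa using hfd
      rw [this] at h'
      rw [h]
      exact D.mul_mem hd (show c' ∈ D.comap κ from (QuotientGroup.eq_one_iff c').1 h'.symm)
    · intro hc
      refine ⟨κ c, hc, 1, by simp, ?_⟩
      rw [QuotientGroup.mk_one, ← map_one χ]; congr 1; ext; simp [hfκ]
  · intro χ χ' h
    have h' : D.twist hκ χ = D.twist hκ χ' := congrArg Subtype.val h
    ext ⟨_, d, hd, rfl⟩
    obtain ⟨c, hc⟩ := QuotientGroup.mk_surjective (χ ⟨f d, Subgroup.mem_map_of_mem f hd⟩)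
    have hm : d * κ c ∈ D.twist hκ χ' := h' ▸ ⟨d, hd, c, rfl, hc.symm⟩
    obtain ⟨d', hd', c', h1, h2⟩ := hm
    have hfd : f d = f d' := by simpa [hfκ] using congrArg f h1
    have h3 : χ' ⟨f d, Subgroup.mem_map_of_mem f hd⟩ = (c' : C ⧸ _) := by
      rw [← h2]; congr 1; ext; exact hfd
    rw [← hc, h3, QuotientGroup.eq]
    obtain ⟨b, rfl⟩ := ex hfd
    have hb : b ∈ D.comap κ := by simpa using D.mul_mem (D.inv_mem hd) hd'
    have h4 : κ c = κ (b * c') := by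
      rw [mul_assoc, mul_right_inj] at h1
      rw [h1, map_mul]
    rw [hinj h4]
    have h5 : (b * c')⁻¹ * c' = b⁻¹ := by
      rw [mul_inv_rev, mul_comm, ← mul_assoc, mul_inv_cancel, one_mul]
    rw [h5]
    exact Subgroup.inv_mem _ hb
  · rintro ⟨D', h1, h2⟩
    have hex (m : D.map f) : ∃ c : C, ∃ d ∈ D, f d = m ∧ d * κ c ∈ D' := by
      obtain ⟨m, hm⟩ := m
      obtain ⟨d, hd, rfl⟩ := id hm
      rw [← h1] at hm
      obtain ⟨d', hd', h⟩ := hm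
      obtain ⟨c, rfl⟩ := ex h.symm
      exact ⟨c, d, hd, rfl, hd'⟩
    choose c d hd hfd hdc using hex
    let χ : D.map f →* C ⧸ D.comap κ := MonoidHom.mk' (fun m => (c m : C ⧸ D.comap κ)) (by
      intro m m'
      rw [← QuotientGroup.mk_mul]
      refine uniq h2 (hd _) (D.mul_mem (hd m) (hd m')) ?_ (hdc _) (c' := c m * c m') ?_
      · rw [hfd, map_mul, hfd, hfd, Subgroup.coe_mul]
      · rw [map_mul, ← (hκ (c m) _).mul_mul_mul_comm]
        exact D'.mul_mem (hdc m) (hdc m'))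
    refine ⟨χ, Subtype.ext (Subgroup.ext fun g => ?_)⟩
    change g ∈ D.twist hκ χ ↔ g ∈ D'
    constructor
    · rintro ⟨d', hd', c', rfl, h⟩
      have h3 : (c ⟨f d', _⟩ : C ⧸ D.comap κ) = c' := h
      have h4 := hdc ⟨f d', Subgroup.mem_map_of_mem f hd'⟩
      have h5 := hd ⟨f d', Subgroup.mem_map_of_mem f hd'⟩
      have h6 := hfd ⟨f d', Subgroup.mem_map_of_mem f hd'⟩
      generalize d ⟨f d', Subgroup.mem_map_of_mem f hd'⟩ = d₀ at *
      generalize c ⟨f d', Subgroup.mem_map_of_mem f hd'⟩ = c₀ at *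
      obtain ⟨b, rfl⟩ := ex h6
      have hbD : b ∈ D.comap κ := by simpa using D.mul_mem (D.inv_mem h5) hd'
      rw [QuotientGroup.eq, ← h2] at h3
      rw [← h2] at hbD
      have := D'.mul_mem (D'.mul_mem h4 h3) hbD
      convert this using 1
      simp only [map_mul, map_inv, mul_assoc]
      rw [mul_inv_cancel_left, (hκ b _).eq]
    · intro hg
      have hfg : f g ∈ D.map f := h1 ▸ Subgroup.mem_map_of_mem f hg
      obtain ⟨d', hd', h⟩ := id hfg
      obtain ⟨c', rfl⟩ := ex h
      refine ⟨d', hd', c', rfl, ?_⟩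
      exact uniq h2 (hd _) hd' (hfd _) (hdc _) hg

end Fiber

/-! ### Lattices in the plane of `p`-power index -/

section Lattice

/-- The determinant of two vectors in `A²`. -/
def det₂ {A : Type*} [CommRing A] (u v : A × A) : A := u.1 * v.2 - u.2 * v.1

/-- The lattice in `ℤ²` spanned by two vectors. -/
def spanPair (u v : ℤ × ℤ) : AddSubgroup (ℤ × ℤ) where
  carrier := {w | ∃ x y : ℤ, w = x • u + y • v}
  zero_mem' := ⟨0, 0, by simp⟩
  add_mem' := by
    rintro _ _ ⟨x, y, rfl⟩ ⟨x', y', rfl⟩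
    exact ⟨x + x', y + y', by module⟩
  neg_mem' := by
    rintro _ ⟨x, y, rfl⟩
    exact ⟨-x, -y, by module⟩

theorem mem_spanPair {u v w : ℤ × ℤ} : w ∈ spanPair u v ↔ ∃ x y : ℤ, w = x • u + y • v := Iff.rfl

theorem left_mem_spanPair (u v : ℤ × ℤ) : u ∈ spanPair u v := ⟨1, 0, by simp⟩

theorem right_mem_spanPair (u v : ℤ × ℤ) : v ∈ spanPair u v := ⟨0, 1, by simp⟩

theorem spanPair_le {u v : ℤ × ℤ} {L : AddSubgroup (ℤ × ℤ)} (hu : u ∈ L) (hv : v ∈ L) :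
    spanPair u v ≤ L := by
  rintro _ ⟨x, y, rfl⟩
  exact L.add_mem (L.zsmul_mem hu x) (L.zsmul_mem hv y)

theorem eq_zero_of_smul_add_smul_eq_zero {A : Type*} [CommRing A] [IsDomain A] {u v : A × A}
    (h : det₂ u v ≠ 0) {x y : A} (hxy : x • u + y • v = 0) : x = 0 ∧ y = 0 := by
  have h1 := congrArg Prod.fst hxy
  have h2 := congrArg Prod.snd hxy
  simp only [Prod.fst_add, Prod.snd_add, Prod.smul_fst, Prod.smul_snd, smul_eq_mul, Prod.fst_zero,
    Prod.snd_zero] at h1 h2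
  constructor
  · refine (mul_eq_zero.1 (?_ : x * det₂ u v = 0)).resolve_right h
    rw [det₂]; linear_combination v.2 * h1 - v.1 * h2
  · refine (mul_eq_zero.1 (?_ : y * det₂ u v = 0)).resolve_right h
    rw [det₂]; linear_combination u.1 * h2 - u.2 * h1

theorem index_spanPair {u v : ℤ × ℤ} (h : det₂ u v ≠ 0) :
    (spanPair u v).index = (det₂ u v).natAbs := by
  let φ : (ℤ × ℤ) →+ spanPair u v :=
    { toFun := fun w => ⟨w.1 • u + w.2 • v, w.1, w.2, rfl⟩
      map_zero' := by simp
      map_add' := fun w w' => by ext <;> simp <;> ring }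
  have hφ : Function.Bijective φ := by
    constructor
    · rw [injective_iff_map_eq_zero]
      intro w hw
      obtain ⟨h1, h2⟩ := eq_zero_of_smul_add_smul_eq_zero h (congrArg Subtype.val hw)
      exact Prod.ext h1 h2
    · rintro ⟨_, x, y, rfl⟩
      exact ⟨(x, y), rfl⟩
  rw [AddSubgroup.index_eq_natAbs_det (Module.Basis.finTwoProd ℤ) _
    ((Module.Basis.finTwoProd ℤ).map (AddEquiv.ofBijective φ hφ).toIntLinearEquiv)]
  congr 1
  rw [Module.Basis.det_apply, Matrix.det_fin_two]
  simp [Module.Basis.toMatrix_apply, φ, det₂]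
  ring

/-- The index set of the sublattices of `ℤ²` of index `p ^ m` with cyclic quotient. -/
abbrev PrimitiveIndex (p m : ℕ) : Type := Fin (p ^ m) ⊕ Fin (if m = 0 then 0 else p ^ (m - 1))

/-- The first vector of a basis of a primitive lattice. -/
def primitiveFst (p : ℕ) {m : ℕ} : PrimitiveIndex p m → ℤ × ℤ
  | .inl t => (t.1, 1)
  | .inr s => (1, p * s.1)

/-- The second vector of a basis of a primitive lattice. -/
def primitiveSnd (p : ℕ) {m : ℕ} : PrimitiveIndex p m → ℤ × ℤ
  | .inl _ => (p ^ m, 0)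
  | .inr _ => (0, p ^ m)

theorem natAbs_det_primitive (p : ℕ) {m : ℕ} (τ : PrimitiveIndex p m) :
    (det₂ (primitiveFst p τ) (primitiveSnd p τ)).natAbs = p ^ m := by
  cases τ <;> simp [det₂, primitiveFst, primitiveSnd, Int.natAbs_pow]

/-- The lattice `p ^ i L`, where `L` is the primitive lattice with index `τ`. -/
def scaledPrimitive (p i : ℕ) {m : ℕ} (τ : PrimitiveIndex p m) : AddSubgroup (ℤ × ℤ) :=
  spanPair ((p ^ i : ℤ) • primitiveFst p τ) ((p ^ i : ℤ) • primitiveSnd p τ)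

theorem mem_scaledPrimitive {p i m : ℕ} {τ : PrimitiveIndex p m} {w : ℤ × ℤ} :
    w ∈ scaledPrimitive p i τ ↔
      ∃ w' ∈ spanPair (primitiveFst p τ) (primitiveSnd p τ), w = (p ^ i : ℤ) • w' := by
  constructor
  · rintro ⟨x, y, rfl⟩
    exact ⟨_, ⟨x, y, rfl⟩, by module⟩
  · rintro ⟨_, ⟨x, y, rfl⟩, rfl⟩
    exact ⟨x, y, by module⟩

theorem natAbs_det_scaledPrimitive (p i : ℕ) {m : ℕ} (τ : PrimitiveIndex p m) :
    (det₂ ((p ^ i : ℤ) • primitiveFst p τ) ((p ^ i : ℤ) • primitiveSnd p τ)).natAbs =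
      p ^ (2 * i + m) := by
  have : det₂ ((p ^ i : ℤ) • primitiveFst p τ) ((p ^ i : ℤ) • primitiveSnd p τ) =
      p ^ (2 * i) * det₂ (primitiveFst p τ) (primitiveSnd p τ) := by
    simp [det₂]; ring
  rw [this, Int.natAbs_mul, natAbs_det_primitive, pow_add]
  simp [Int.natAbs_pow]

theorem index_scaledPrimitive {p : ℕ} (hp : p.Prime) (i : ℕ) {m : ℕ} (τ : PrimitiveIndex p m) :
    (scaledPrimitive p i τ).index = p ^ (2 * i + m) := by
  rw [scaledPrimitive, index_spanPair, natAbs_det_scaledPrimitive]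
  rw [← Int.natAbs_ne_zero, natAbs_det_scaledPrimitive]
  exact pow_ne_zero _ hp.ne_zero

theorem exists_forall_mem_iff_dvd {p n : ℕ} (hp : p.Prime) (H : AddSubgroup ℤ)
    (h : (p ^ n : ℤ) ∈ H) : ∃ m : ℕ, ∀ a : ℤ, a ∈ H ↔ (p ^ m : ℤ) ∣ a := by
  obtain ⟨d, rfl⟩ := Int.subgroup_cyclic H
  simp only [AddSubgroup.mem_closure_singleton, smul_eq_mul] at h ⊢
  obtain ⟨c, hc⟩ := h
  have hd : d.natAbs ∣ p ^ n := by
    simpa [Int.natAbs_pow] using Int.natAbs_dvd_natAbs.2 (Dvd.intro_left c hc)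
  obtain ⟨m, -, hm⟩ := (Nat.dvd_prime_pow hp).1 hd
  refine ⟨m, fun a => ?_⟩
  have hdm : (p ^ m : ℤ) = d.natAbs := by rw [hm]; push_cast; rfl
  rw [hdm, Int.natAbs_dvd]
  exact ⟨fun ⟨x, hx⟩ => ⟨x, by rw [← hx, mul_comm]⟩, fun ⟨x, hx⟩ => ⟨x, by rw [hx, mul_comm]⟩⟩

/-- Hermite normal form over a local ring: a vector of `L` with a coordinate prime to `p` can be
scaled so that this coordinate is `1`, as `L` contains `p ^ n ℤ²`. The elements of `L` on the other
axis are the multiples of some `p ^ m`, and the remaining coordinate is reduced modulo `p ^ m`. -/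
theorem exists_eq_primitive {p n : ℕ} (hp : p.Prime) {L : AddSubgroup (ℤ × ℤ)}
    (hL : ∀ w : ℤ × ℤ, (p ^ n : ℤ) • w ∈ L)
    (hprim : ∃ w ∈ L, ¬ ((p : ℤ) ∣ w.1 ∧ (p : ℤ) ∣ w.2)) :
    ∃ (m : ℕ) (τ : PrimitiveIndex p m), L = spanPair (primitiveFst p τ) (primitiveSnd p τ) := by
  have hpZ : Prime (p : ℤ) := Nat.prime_iff_prime_int.1 hp
  have hppos (m : ℕ) : (0 : ℤ) < p ^ m := by have := hp.pos; positivity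
  have cop {a : ℤ} (ha : ¬ (p : ℤ) ∣ a) : ∃ x y : ℤ, x * a + y * p ^ n = 1 :=
    (((Prime.coprime_iff_not_dvd hpZ).2 ha).symm.pow_right : IsCoprime a ((p : ℤ) ^ n))
  by_cases hA : ∃ w ∈ L, ¬ (p : ℤ) ∣ w.2
  · obtain ⟨w, hw, hpw⟩ := hA
    obtain ⟨x, y, hxy⟩ := cop hpw
    have hr : (x * w.1, 1) ∈ L := by
      have := L.add_mem (L.zsmul_mem hw x) (L.zsmul_mem (hL (0, 1)) y)
      convert this using 1
      ext
      · simp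
      · simpa using hxy.symm
    generalize x * w.1 = r at hr
    obtain ⟨m, hm⟩ := exists_forall_mem_iff_dvd (n := n) hp (L.comap (AddMonoidHom.inl ℤ ℤ))
      (by simpa using hL (1, 0))
    simp only [AddSubgroup.mem_comap, AddMonoidHom.inl_apply] at hm
    have ht0 := Int.emod_nonneg r (hppos m).ne'
    have ht1 := Int.emod_lt_of_pos r (hppos m)
    have htr : (p ^ m : ℤ) ∣ r % p ^ m - r := ⟨-(r / p ^ m), by rw [Int.emod_def]; ring⟩
    lift r % (p ^ m : ℤ) to ℕ using ht0 with t
    refine ⟨m, .inl ⟨t, by exact_mod_cast ht1⟩, le_antisymm ?_ (spanPair_le ?_ ?_)⟩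
    · intro w hw
      have h1 : (w.1 - w.2 * r, 0) ∈ L := by
        convert L.sub_mem hw (L.zsmul_mem hr w.2) using 1
        ext <;> simp
      obtain ⟨c, hc⟩ := (hm _).1 h1
      obtain ⟨c', hc'⟩ := htr
      refine ⟨w.2, c - w.2 * c', ?_⟩
      ext
      · simp [primitiveFst, primitiveSnd]; linear_combination hc - w.2 * hc'
      · simp [primitiveFst, primitiveSnd]
    · convert L.add_mem hr ((hm _).2 htr) using 1
      ext <;> simp [primitiveFst]
    · exact (hm _).2 dvd_rfl
  · push Not at hA
    obtain ⟨w, hw, hpw⟩ := hprim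
    replace hpw : ¬ (p : ℤ) ∣ w.1 := fun h => hpw ⟨h, hA w hw⟩
    obtain ⟨x, y, hxy⟩ := cop hpw
    have hr : (1, x * w.2) ∈ L := by
      have := L.add_mem (L.zsmul_mem hw x) (L.zsmul_mem (hL (1, 0)) y)
      convert this using 1
      ext
      · simpa using hxy.symm
      · simp
    generalize x * w.2 = r at hr
    obtain ⟨m, hm⟩ := exists_forall_mem_iff_dvd (n := n) hp (L.comap (AddMonoidHom.inr ℤ ℤ))
      (by simpa using hL (0, 1))
    simp only [AddSubgroup.mem_comap, AddMonoidHom.inr_apply] at hm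
    -- In this case every second coordinate in `L` is divisible by `p`. This excludes `m = 0` and
    -- makes `r` a multiple of `p`, which leaves `p ^ (m - 1)` residues.
    have hm0 : m ≠ 0 := by
      rintro rfl
      have := hA _ ((hm 1).2 (by simp))
      exact hpZ.not_dvd_one this
    obtain ⟨m, rfl⟩ := Nat.exists_eq_add_one_of_ne_zero hm0
    obtain ⟨r, rfl⟩ := hA _ hr
    have ht0 := Int.emod_nonneg r (hppos m).ne'
    have ht1 := Int.emod_lt_of_pos r (hppos m)
    have htr : (p ^ m : ℤ) ∣ r % p ^ m - r := ⟨-(r / p ^ m), by rw [Int.emod_def]; ring⟩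
    lift r % (p ^ m : ℤ) to ℕ using ht0 with s
    refine ⟨m + 1, .inr ⟨s, by simpa using (by exact_mod_cast ht1 : s < p ^ m)⟩,
      le_antisymm ?_ (spanPair_le ?_ ?_)⟩
    · intro w hw
      have h1 : (0, w.2 - w.1 * (p * r)) ∈ L := by
        convert L.sub_mem hw (L.zsmul_mem hr w.1) using 1
        ext <;> simp
      obtain ⟨c, hc⟩ := (hm _).1 h1
      obtain ⟨c', hc'⟩ := htr
      refine ⟨w.1, c - w.1 * c', ?_⟩
      ext
      · simp [primitiveFst, primitiveSnd]
      · simp [primitiveFst, primitiveSnd]; linear_combination hc - p * w.1 * hc'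
    · have : ((p ^ (m + 1) : ℕ) : ℤ) ∣ p * (s - r) := by
        push_cast; rw [pow_succ']; exact mul_dvd_mul_left _ htr
      convert L.add_mem hr ((hm _).2 (by exact_mod_cast this)) using 1
      ext <;> simp [primitiveFst]; ring
    · exact (hm _).2 dvd_rfl

theorem exists_eq_scaledPrimitive {p n : ℕ} (hp : p.Prime) {L : AddSubgroup (ℤ × ℤ)}
    (hL : ∀ w : ℤ × ℤ, (p ^ n : ℤ) • w ∈ L) :
    ∃ (i m : ℕ) (τ : PrimitiveIndex p m), L = scaledPrimitive p i τ := by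
  classical
  have hpos (m : ℕ) : (0 : ℤ) < p ^ m := by have := hp.pos; positivity
  -- `P i` says that `L ⊆ p ^ i ℤ²`. For the largest such `i`, the lattice `p ^ (-i) L` is
  -- primitive.
  let P : ℕ → Prop := fun i => ∀ w ∈ L, ∃ w', w = (p ^ i : ℤ) • w'
  have hbound (i : ℕ) (hi : P i) : i ≤ n := by
    obtain ⟨w', hw⟩ := hi _ (hL (1, 0))
    have h1 := congrArg Prod.fst hw
    simp only [Prod.smul_fst, smul_eq_mul, mul_one] at h1
    have : ((p ^ i : ℕ) : ℤ) ∣ ((p ^ n : ℕ) : ℤ) := ⟨w'.1, by push_cast; exact h1⟩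
    exact (Nat.pow_dvd_pow_iff_le_right hp.one_lt).1 (by exact_mod_cast this)
  have h0 : P 0 := fun w _ => ⟨w, by simp⟩
  have hspec := Nat.findGreatest_spec (P := P) (Nat.zero_le n) h0
  set i := Nat.findGreatest P n with hi
  have hsucc : ¬ P (i + 1) := fun h => by
    have := Nat.le_findGreatest (hbound _ h) h
    omega
  obtain ⟨m, τ, hτ⟩ := exists_eq_primitive (n := n) hp
    (L := L.comap (DistribSMul.toAddMonoidHom (ℤ × ℤ) (p ^ i : ℤ)))
    (fun w => by
      simp only [AddSubgroup.mem_comap, DistribSMul.toAddMonoidHom_apply]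
      exact L.zsmul_mem (hL w) _)
    (by
      by_contra! hcon
      refine hsucc fun w hw => ?_
      obtain ⟨w', rfl⟩ := hspec w hw
      obtain ⟨⟨a, ha⟩, b, hb⟩ := hcon w' hw
      refine ⟨(a, b), ?_⟩
      ext
      · simp [ha]; ring
      · simp [hb]; ring)
  refine ⟨i, m, τ, ?_⟩
  ext w
  rw [mem_scaledPrimitive, ← hτ]
  constructor
  · intro hw
    obtain ⟨w', rfl⟩ := hspec w hw
    exact ⟨w', hw, rfl⟩
  · rintro ⟨w', hw', rfl⟩
    exact hw'

theorem exists_mem_primitive_not_dvd {p : ℕ} (hp : p.Prime) {m : ℕ} (τ : PrimitiveIndex p m) :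
    ∃ w ∈ spanPair (primitiveFst p τ) (primitiveSnd p τ),
      ¬ ((p : ℤ) ∣ w.1 ∧ (p : ℤ) ∣ w.2) := by
  have hpZ : Prime (p : ℤ) := Nat.prime_iff_prime_int.1 hp
  refine ⟨_, left_mem_spanPair _ _, ?_⟩
  cases τ with
  | inl t => exact fun h => hpZ.not_dvd_one h.2
  | inr t => exact fun h => hpZ.not_dvd_one h.1

/-- A primitive lattice contains a vector not divisible by `p`, so `i` is recovered as the largest
exponent with `p ^ i` dividing all vectors. -/
theorem scaledPrimitive_exponent_le {p : ℕ} (hp : p.Prime) {i j m n : ℕ} {τ : PrimitiveIndex p m}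
    {σ : PrimitiveIndex p n} (h : scaledPrimitive p i τ = scaledPrimitive p j σ) : j ≤ i := by
  obtain ⟨w, hw, hw'⟩ := exists_mem_primitive_not_dvd hp τ
  by_contra! hij
  obtain ⟨k, rfl⟩ := Nat.exists_eq_add_of_lt hij
  have hmem : (p ^ i : ℤ) • w ∈ scaledPrimitive p (i + k + 1) σ :=
    h ▸ mem_scaledPrimitive.2 ⟨w, hw, rfl⟩
  obtain ⟨v, -, hv⟩ := mem_scaledPrimitive.1 hmem
  have hpos : (p ^ i : ℤ) ≠ 0 := pow_ne_zero _ (by exact_mod_cast hp.ne_zero)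
  refine hw' ⟨⟨p ^ k * v.1, ?_⟩, ⟨p ^ k * v.2, ?_⟩⟩ <;> apply mul_left_cancel₀ hpos
  · have := congrArg Prod.fst hv
    simp only [Prod.smul_fst, smul_eq_mul] at this
    rw [this]; ring
  · have := congrArg Prod.snd hv
    simp only [Prod.smul_snd, smul_eq_mul] at this
    rw [this]; ring

theorem scaledPrimitive_exponent_eq {p : ℕ} (hp : p.Prime) {i j m n : ℕ} {τ : PrimitiveIndex p m}
    {σ : PrimitiveIndex p n} (h : scaledPrimitive p i τ = scaledPrimitive p j σ) : i = j :=
  le_antisymm (scaledPrimitive_exponent_le hp h.symm) (scaledPrimitive_exponent_le hp h)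

theorem primitive_injective {p : ℕ} (hp : p.Prime) {m : ℕ} {τ σ : PrimitiveIndex p m}
    (h : spanPair (primitiveFst p τ) (primitiveSnd p τ) =
      spanPair (primitiveFst p σ) (primitiveSnd p σ)) : τ = σ := by
  have hpZ : Prime (p : ℤ) := Nat.prime_iff_prime_int.1 hp
  have mixed (t : Fin (p ^ m)) (s : Fin (if m = 0 then 0 else p ^ (m - 1)))
      (h : ((t.1, 1) : ℤ × ℤ) ∈ spanPair (1, (p * s.1 : ℤ)) (0, (p ^ m : ℤ))) : False := by
    obtain ⟨x, y, hxy⟩ := h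
    have hm : m ≠ 0 := by rintro rfl; exact (by simpa using s.2)
    have h2 := congrArg Prod.snd hxy
    simp at h2
    refine hpZ.not_dvd_one (h2 ▸ dvd_add ⟨x * s.1, by ring⟩ ?_)
    exact Dvd.dvd.mul_left (dvd_pow_self _ hm) _
  rcases τ with t | s <;> rcases σ with t' | s'
  · have h1 := h ▸ left_mem_spanPair (primitiveFst p (.inl t)) (primitiveSnd p (.inl t))
    obtain ⟨x, y, hxy⟩ := h1
    have e1 := congrArg Prod.fst hxy
    have e2 := congrArg Prod.snd hxy
    simp [primitiveFst, primitiveSnd] at e1 e2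
    subst e2
    congr 1
    ext
    have : (t : ℕ) ≡ t' [MOD p ^ m] := by
      rw [← Int.natCast_modEq_iff]
      refine (Int.modEq_iff_dvd.2 ⟨-y, ?_⟩)
      push_cast; linear_combination -e1
    exact this.eq_of_lt_of_lt t.2 t'.2
  · exact (mixed t s' (h ▸ left_mem_spanPair (primitiveFst p (.inl t)) _)).elim
  · exact (mixed t' s (h ▸ left_mem_spanPair (primitiveFst p (.inl t')) _)).elim
  · have h1 := h ▸ left_mem_spanPair (primitiveFst p (.inr s)) (primitiveSnd p (.inr s))
    obtain ⟨x, y, hxy⟩ := h1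
    have e1 := congrArg Prod.fst hxy
    have e2 := congrArg Prod.snd hxy
    simp [primitiveFst, primitiveSnd] at e1 e2
    subst e1
    have hm : m ≠ 0 := by rintro rfl; exact (by simpa using s.2)
    obtain ⟨k, rfl⟩ := Nat.exists_eq_add_one_of_ne_zero hm
    have hs : (s : ℕ) < p ^ k := by simpa using s.2
    have hs' : (s' : ℕ) < p ^ k := by simpa using s'.2
    congr 1
    ext
    have : (s : ℕ) ≡ s' [MOD p ^ k] := by
      rw [← Int.natCast_modEq_iff]
      refine (Int.modEq_iff_dvd.2 ⟨-y, ?_⟩)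
      have hp0 : (p : ℤ) ≠ 0 := by exact_mod_cast hp.ne_zero
      apply mul_left_cancel₀ hp0
      push_cast; linear_combination -e2
    exact this.eq_of_lt_of_lt hs hs'

theorem scaledPrimitive_injective {p : ℕ} (hp : p.Prime) {i m : ℕ} {τ σ : PrimitiveIndex p m}
    (h : scaledPrimitive p i τ = scaledPrimitive p i σ) : τ = σ := by
  refine primitive_injective hp ?_
  have hpos : (p ^ i : ℤ) ≠ 0 := pow_ne_zero _ (by exact_mod_cast hp.ne_zero)
  ext w
  have key (τ : PrimitiveIndex p m) : w ∈ spanPair (primitiveFst p τ) (primitiveSnd p τ) ↔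
      (p ^ i : ℤ) • w ∈ scaledPrimitive p i τ := by
    rw [mem_scaledPrimitive]
    constructor
    · exact fun hw => ⟨w, hw, rfl⟩
    · rintro ⟨w', hw', e⟩
      rwa [smul_right_injective _ hpos e]
  rw [key, key, h]

end Lattice

/-! ### Indices and comparison of subgroups in a central extension -/

section Extension

variable {G Q C : Type*} [Group G] [Group Q] [CommGroup C] {κ : C →* G} {f : G →* Q}

/-- The central subgroup normalizes `D`, so the second isomorphism theorem identifies the index of
`D` in its product with the centre with the index of the intersection in the centre. -/
theorem index_eq_index_map_mul_index_comap (hκ : ∀ c g, Commute (κ c) g) (hf : f.ker = κ.range)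
    (hsurj : Function.Surjective f) (D : Subgroup G) :
    D.index = (D.map f).index * (D.comap κ).index := by
  have hnorm : κ.range ≤ Subgroup.normalizer (D : Set G) := by
    rintro _ ⟨c, rfl⟩
    rw [Subgroup.mem_normalizer_iff]
    intro g
    rw [(hκ c g).eq, mul_inv_cancel_right]
  have := Subgroup.normal_subgroupOf_of_le_normalizer hnorm
  have := Subgroup.normal_subgroupOf_sup_of_le_normalizer hnorm
  have h1 : D.relIndex (κ.range ⊔ D) = D.relIndex κ.range :=
    (Nat.card_congr (QuotientGroup.quotientInfEquivProdNormalizerQuotient _ D hnorm).toEquiv).symm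
  rw [Subgroup.index_map, Subgroup.index_comap, hf, MonoidHom.range_eq_top.2 hsurj,
    Subgroup.index_top, mul_one, ← h1, sup_comm, mul_comm, Subgroup.relIndex_mul_index le_sup_right]

/-- A form of the five lemma; it upgrades the inclusion of a subgroup spanned by a frame to an
equality. -/
theorem subgroup_eq_of_le_of_map_eq (hf : f.ker = κ.range) {D D' : Subgroup G} (hle : D ≤ D')
    (hmap : D.map f = D'.map f) (hcomap : D.comap κ = D'.comap κ) : D = D' := by
  refine le_antisymm hle fun g hg => ?_
  obtain ⟨d, hd, h⟩ := hmap ▸ Subgroup.mem_map_of_mem f hg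
  have : d⁻¹ * g ∈ κ.range := hf ▸ (by simp [MonoidHom.mem_ker, h])
  obtain ⟨c, hc⟩ := this
  have hc' : c ∈ D'.comap κ := by
    rw [Subgroup.mem_comap, hc]
    exact D'.mul_mem (D'.inv_mem (hle hd)) hg
  rw [← hcomap, Subgroup.mem_comap, hc] at hc'
  simpa using D.mul_mem hd hc'

theorem card_subgroup_fiber_of_range (hinj : Function.Injective κ)
    (hκ : ∀ c g, Commute (κ c) g) (hf : f.ker = κ.range) (D : Subgroup G) {r : ℕ}
    (ψ : Multiplicative (Fin r → ℤ) →* Q) (hψ : Function.Injective ψ) (hD : ψ.range = D.map f) :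
    Nat.card {D' : Subgroup G // D'.map f = D.map f ∧ D'.comap κ = D.comap κ} =
      (D.comap κ).index ^ r :=
  card_subgroup_fiber hinj hκ hf D
    ((ψ.ofInjective hψ).trans (MulEquiv.subgroupCongr hD)).symm

end Extension

/-! ### Layers of the Heisenberg group, commutator pairing and frames -/

namespace Heis

/-- The group `ℤ²` in multiplicative notation. -/
abbrev Plane : Type := Multiplicative (ℤ × ℤ)

/-- The projection of the Heisenberg group onto its quotient modulo the centre. -/
def proj : Heis ℤ →* Plane × Plane where
  toFun g := (.ofAdd (g.a0, g.b0), .ofAdd (g.a1, g.b1))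
  map_one' := rfl
  map_mul' _ _ := rfl

/-- The inclusion of the centre of the Heisenberg group. -/
def center : Plane →* Heis ℤ where
  toFun t := ⟨0, 0, 0, 0, t.toAdd.1, t.toAdd.2⟩
  map_one' := rfl
  map_mul' _ _ := by ext <;> simp

theorem proj_apply (g : Heis ℤ) : proj g = (.ofAdd (g.a0, g.b0), .ofAdd (g.a1, g.b1)) := rfl

theorem center_apply (t : Plane) : center t = ⟨0, 0, 0, 0, t.toAdd.1, t.toAdd.2⟩ := rfl

theorem center_injective : Function.Injective center := by
  intro t t' h
  have h1 := congrArg Heis.c0 h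
  have h2 := congrArg Heis.c1 h
  exact Prod.ext h1 h2

theorem center_commute (t : Plane) (g : Heis ℤ) : Commute (center t) g := by
  ext <;> simp [center_apply, add_comm]

theorem proj_surjective : Function.Surjective proj :=
  fun m => ⟨⟨m.1.toAdd.1, m.2.toAdd.1, m.1.toAdd.2, m.2.toAdd.2, 0, 0⟩, rfl⟩

theorem ker_proj : proj.ker = center.range := by
  ext g
  rw [MonoidHom.mem_ker, MonoidHom.mem_range]
  constructor
  · intro h
    refine ⟨.ofAdd (g.c0, g.c1), ?_⟩
    have h1 := congrArg (fun m : Plane × Plane => m.1.toAdd) h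
    have h2 := congrArg (fun m : Plane × Plane => m.2.toAdd) h
    simp [proj_apply] at h1 h2
    ext <;> simp [center_apply, h1, h2]
  · rintro ⟨t, rfl⟩
    rfl

theorem ker_fst_eq_range_inr :
    (MonoidHom.fst Plane Plane).ker = (MonoidHom.inr Plane Plane).range := by
  ext ⟨a, b⟩
  simp [Subgroup.mem_prod, eq_comm (a := a)]

theorem inr_commute (t : Plane) (m : Plane × Plane) :
    Commute (MonoidHom.inr Plane Plane t) m := Commute.all _ _

theorem inr_injective : Function.Injective (MonoidHom.inr Plane Plane) :=
  fun _ _ h => congrArg Prod.snd h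

/-- The commutator pairing on the quotient of the Heisenberg group modulo its centre. -/
def bracket (m m' : Plane × Plane) : Plane :=
  .ofAdd (det₂ m.1.toAdd m'.1.toAdd, det₂ m.1.toAdd m'.2.toAdd + det₂ m.2.toAdd m'.1.toAdd)

/-- Commutators depend only on the classes modulo the centre. Hence `derived` can be computed from
the image `M` alone, and the central layer is the same for all subgroups counted above `M`. -/
theorem center_bracket (g h : Heis ℤ) : center (bracket (proj g) (proj h)) = ⁅g, h⁆ := by
  ext <;> simp [center_apply, bracket, proj_apply, det₂, commutatorElement_def] <;> ring

/-- The subgroup generated by the values of the commutator pairing. -/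
def derived (M : Subgroup (Plane × Plane)) : Subgroup Plane :=
  Subgroup.closure {t | ∃ m ∈ M, ∃ m' ∈ M, t = bracket m m'}

theorem derived_map_proj_le (D : Subgroup (Heis ℤ)) : derived (D.map proj) ≤ D.comap center := by
  rw [derived, Subgroup.closure_le]
  rintro _ ⟨_, ⟨g, hg, rfl⟩, _, ⟨h, hh, rfl⟩, rfl⟩
  rw [SetLike.mem_coe, Subgroup.mem_comap, center_bracket, commutatorElement_def]
  exact D.mul_mem (D.mul_mem (D.mul_mem hg hh) (D.inv_mem hg)) (D.inv_mem hh)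

section Zpow

variable {A : Type*} [CommRing A] (g : Heis A) (n : ℤ)

@[simp] theorem zpow_a0 : (g ^ n).a0 = n * g.a0 := by
  obtain ⟨q, -, h⟩ := exists_zpow_eq_formalPow (A := A) n
  rw [h]; rfl
@[simp] theorem zpow_a1 : (g ^ n).a1 = n * g.a1 := by
  obtain ⟨q, -, h⟩ := exists_zpow_eq_formalPow (A := A) n
  rw [h]; rfl
@[simp] theorem zpow_b0 : (g ^ n).b0 = n * g.b0 := by
  obtain ⟨q, -, h⟩ := exists_zpow_eq_formalPow (A := A) n
  rw [h]; rfl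
@[simp] theorem zpow_b1 : (g ^ n).b1 = n * g.b1 := by
  obtain ⟨q, -, h⟩ := exists_zpow_eq_formalPow (A := A) n
  rw [h]; rfl

end Zpow

/-- Elements of the Heisenberg group spanning a subgroup isomorphic to the whole group. -/
structure IsFrame (X₁ X₂ Y₁ Y₂ : Heis ℤ) : Prop where
  X₂a : X₂.a0 = 0
  X₂b : X₂.b0 = 0
  Y₁a : Y₁.a0 = 0
  Y₁b : Y₁.b0 = 0
  xx : det₂ (X₁.a0, X₁.b0) (X₂.a1, X₂.b1) = 0
  yy : det₂ (Y₁.a1, Y₁.b1) (Y₂.a0, Y₂.b0) = 0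
  xy : det₂ (X₁.a0, X₁.b0) (Y₁.a1, Y₁.b1) = det₂ (X₂.a1, X₂.b1) (Y₂.a0, Y₂.b0)
  det_ne : det₂ (X₁.a0, X₁.b0) (Y₂.a0, Y₂.b0) ≠ 0
  det_ne' : det₂ (X₂.a1, X₂.b1) (Y₁.a1, Y₁.b1) ≠ 0
  det_ne'' : det₂ (X₁.a0, X₁.b0) (Y₁.a1, Y₁.b1) ≠ 0

namespace IsFrame

variable {X₁ X₂ Y₁ Y₂ : Heis ℤ} (h : IsFrame X₁ X₂ Y₁ Y₂)
include h

/-- The determinant conditions of a frame are the coordinates of the relations between commutators;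
`X₂` and `Y₁` commute because both have no constant part. -/
theorem relations : Relations X₁ X₂ Y₁ Y₂ (center (bracket (proj X₁) (proj Y₁)))
    (center (bracket (proj X₁) (proj Y₂))) := by
  obtain ⟨h1, h2, h3, h4, h5, h6, h7, -, -, -⟩ := h
  simp only [det₂] at h5 h6 h7
  refine ⟨center_commute _, center_commute _, ?_, ?_, ?_, ?_, ?_, ?_⟩
  · ext <;> simp [h1, h2, add_comm]; linear_combination h5
  · ext <;> simp [h3, h4, add_comm]; linear_combination h6
  · ext <;> simp [h1, h2, h3, h4, add_comm]
  · ext <;> simp [h3, h4, center_apply, bracket, proj_apply, det₂, add_comm]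
    ring
  · ext <;> simp [h1, h2, h3, h4, center_apply, bracket, proj_apply, det₂, add_comm]
    linear_combination -h7
  · ext <;> simp [center_apply, bracket, proj_apply, det₂, add_comm] <;> ring

theorem proj_lift (g : Heis ℤ) : proj (lift h.relations g) =
    (.ofAdd (g.a0 • (X₁.a0, X₁.b0) + g.b0 • (Y₂.a0, Y₂.b0)),
      .ofAdd (g.a0 • (X₁.a1, X₁.b1) + g.b0 • (Y₂.a1, Y₂.b1) + (g.a1 • (X₂.a1, X₂.b1) +
        g.b1 • (Y₁.a1, Y₁.b1)))) := by
  obtain ⟨h1, h2, h3, h4, -⟩ := h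
  rw [proj_apply, lift_apply]
  refine Prod.ext ?_ ?_ <;> refine congrArg Multiplicative.ofAdd (Prod.ext ?_ ?_) <;>
    simp [h1, h2, h3, h4, center_apply] <;> ring

theorem lift_of_eq_zero {g : Heis ℤ} (ha : g.a0 = 0) (ha' : g.a1 = 0) (hb : g.b0 = 0)
    (hb' : g.b1 = 0) : lift h.relations g = center
      (bracket (proj X₁) (proj Y₂) ^ g.c0 * bracket (proj X₁) (proj Y₁) ^ g.c1) := by
  rw [lift_apply, ha, ha', hb, hb', map_mul, map_zpow, map_zpow]
  simp

theorem bracket_Y₁ : bracket (proj X₁) (proj Y₁) =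
    .ofAdd (0, det₂ (X₁.a0, X₁.b0) (Y₁.a1, Y₁.b1)) := by
  simp [bracket, proj_apply, h.Y₁a, h.Y₁b, det₂]

/-- The matrix is triangular, so the higher coordinates `a1`, `b1` of `X₁` and `Y₂` do not matter,
and any lifts may be used in a frame. -/
theorem det_bracket :
    det₂ (bracket (proj X₁) (proj Y₁)).toAdd (bracket (proj X₁) (proj Y₂)).toAdd =
      - (det₂ (X₁.a0, X₁.b0) (Y₁.a1, Y₁.b1) * det₂ (X₁.a0, X₁.b0) (Y₂.a0, Y₂.b0)) := by
  rw [h.bracket_Y₁]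
  simp [bracket, proj_apply, det₂]

theorem det_bracket_ne_zero :
    det₂ (bracket (proj X₁) (proj Y₁)).toAdd (bracket (proj X₁) (proj Y₂)).toAdd ≠ 0 := by
  rw [h.det_bracket, neg_ne_zero]
  exact mul_ne_zero h.det_ne'' h.det_ne

theorem eq_zero_of_fst_proj_lift {g : Heis ℤ} (hg : (proj (lift h.relations g)).1 = 1) :
    g.a0 = 0 ∧ g.b0 = 0 := by
  rw [h.proj_lift] at hg
  exact eq_zero_of_smul_add_smul_eq_zero h.det_ne hg

theorem eq_zero_of_proj_lift {g : Heis ℤ} (hg : proj (lift h.relations g) = 1) :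
    (g.a0 = 0 ∧ g.b0 = 0) ∧ g.a1 = 0 ∧ g.b1 = 0 := by
  have h1 := h.eq_zero_of_fst_proj_lift (congrArg Prod.fst hg)
  rw [h.proj_lift, h1.1, h1.2] at hg
  refine ⟨h1, eq_zero_of_smul_add_smul_eq_zero h.det_ne' ?_⟩
  simpa using congrArg (fun m : Plane × Plane => m.2.toAdd) hg

/-- Each layer is handled by one nonzero determinant: `(a0, b0)`, then `(a1, b1)`, then the centre.
-/
theorem lift_injective : Function.Injective (lift h.relations) := by
  rw [injective_iff_map_eq_one]
  intro g hg
  obtain ⟨⟨h1, h2⟩, h3, h4⟩ := h.eq_zero_of_proj_lift (by rw [hg, map_one])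
  rw [h.lift_of_eq_zero h1 h3 h2 h4] at hg
  have h5 := center_injective (hg.trans (map_one center).symm)
  rw [mul_comm] at h5
  obtain ⟨h6, h7⟩ := eq_zero_of_smul_add_smul_eq_zero h.det_bracket_ne_zero h5
  exact Heis.ext h1 h3 h2 h4 h7 h6

theorem comap_center_range : (lift h.relations).range.comap center =
    (spanPair (bracket (proj X₁) (proj Y₁)).toAdd
      (bracket (proj X₁) (proj Y₂)).toAdd).toSubgroup := by
  ext t
  rw [Subgroup.mem_comap, MonoidHom.mem_range, Multiplicative.mem_toSubgroup, mem_spanPair]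
  constructor
  · rintro ⟨g, hg⟩
    obtain ⟨⟨h1, h2⟩, h3, h4⟩ := h.eq_zero_of_proj_lift (g := g) (by rw [hg]; rfl)
    rw [h.lift_of_eq_zero h1 h3 h2 h4] at hg
    exact ⟨g.c1, g.c0, by rw [← center_injective hg, mul_comm]; rfl⟩
  · rintro ⟨x, y, hxy⟩
    refine ⟨⟨0, 0, 0, 0, y, x⟩, ?_⟩
    rw [h.lift_of_eq_zero rfl rfl rfl rfl, mul_comm]
    exact congrArg center hxy.symm

theorem mem_range : X₁ ∈ (lift h.relations).range ∧ X₂ ∈ (lift h.relations).range ∧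
    Y₁ ∈ (lift h.relations).range ∧ Y₂ ∈ (lift h.relations).range :=
  ⟨⟨x₁ ℤ, by simp [lift_apply, x₁]⟩, ⟨x₂ ℤ, by simp [lift_apply, x₂]⟩,
    ⟨y₁ ℤ, by simp [lift_apply, y₁]⟩, ⟨y₂ ℤ, by simp [lift_apply, y₂]⟩⟩

theorem derived_map_range :
    derived ((lift h.relations).range.map proj) = (lift h.relations).range.comap center := by
  refine le_antisymm (derived_map_proj_le _) ?_
  rw [h.comap_center_range]
  obtain ⟨hX₁, -, hY₁, hY₂⟩ := h.mem_range
  rintro t ⟨x, y, hxy⟩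
  have ht : t = bracket (proj X₁) (proj Y₁) ^ x * bracket (proj X₁) (proj Y₂) ^ y := hxy
  rw [ht]
  refine Subgroup.mul_mem _ (Subgroup.zpow_mem _ (Subgroup.subset_closure ?_) _)
    (Subgroup.zpow_mem _ (Subgroup.subset_closure ?_) _)
  · exact ⟨_, Subgroup.mem_map_of_mem _ hX₁, _, Subgroup.mem_map_of_mem _ hY₁, rfl⟩
  · exact ⟨_, Subgroup.mem_map_of_mem _ hX₁, _, Subgroup.mem_map_of_mem _ hY₂, rfl⟩

theorem range_le {D : Subgroup (Heis ℤ)} (hX₁ : X₁ ∈ D) (hX₂ : X₂ ∈ D) (hY₁ : Y₁ ∈ D)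
    (hY₂ : Y₂ ∈ D) : (lift h.relations).range ≤ D := by
  rintro _ ⟨g, rfl⟩
  have hc {X Y : Heis ℤ} (hX : X ∈ D) (hY : Y ∈ D) : center (bracket (proj X) (proj Y)) ∈ D :=
    derived_map_proj_le D (Subgroup.subset_closure
      ⟨_, Subgroup.mem_map_of_mem _ hX, _, Subgroup.mem_map_of_mem _ hY, rfl⟩)
  rw [lift_apply]
  exact D.mul_mem (D.mul_mem (D.mul_mem (D.zpow_mem hY₂ _) (D.zpow_mem hY₁ _))
    (D.mul_mem (D.zpow_mem hX₁ _) (D.zpow_mem hX₂ _)))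
    (D.mul_mem (D.zpow_mem (hc hX₁ hY₂) _) (D.zpow_mem (hc hX₁ hY₁) _))

/-- A subgroup of `Plane × Plane` is determined, among those containing a given one, by its first
projection and its second kernel layer; the frame spans both. -/
theorem map_proj_range {M : Subgroup (Plane × Plane)} (hX₁ : proj X₁ ∈ M) (hX₂ : proj X₂ ∈ M)
    (hY₁ : proj Y₁ ∈ M) (hY₂ : proj Y₂ ∈ M)
    (h1 : M.map (MonoidHom.fst _ _) ≤ (spanPair (X₁.a0, X₁.b0) (Y₂.a0, Y₂.b0)).toSubgroup)
    (h0 : M.comap (MonoidHom.inr _ _) ≤ (spanPair (X₂.a1, X₂.b1) (Y₁.a1, Y₁.b1)).toSubgroup) :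
    (lift h.relations).range.map proj = M := by
  have hle : (lift h.relations).range.map proj ≤ M :=
    Subgroup.map_le_iff_le_comap.2 (h.range_le hX₁ hX₂ hY₁ hY₂)
  refine subgroup_eq_of_le_of_map_eq ker_fst_eq_range_inr hle
    (le_antisymm (Subgroup.map_mono hle) (h1.trans ?_))
    (le_antisymm (Subgroup.comap_mono hle) (h0.trans ?_))
  · rintro t ⟨x, y, hxy⟩
    refine ⟨_, Subgroup.mem_map_of_mem proj ⟨⟨x, 0, y, 0, 0, 0⟩, rfl⟩, ?_⟩
    rw [h.proj_lift]
    exact hxy.symm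
  · rintro t ⟨x, y, hxy⟩
    refine ⟨_, ⟨⟨0, x, 0, y, 0, 0⟩, rfl⟩, ?_⟩
    rw [h.proj_lift]
    refine Prod.ext ?_ ?_
    · simp
    · simp only [zero_smul, zero_add]
      exact hxy.symm

theorem card_fiber :
    Nat.card {D : Subgroup (Heis ℤ) // D.map proj = (lift h.relations).range.map proj ∧
      D.comap center = derived ((lift h.relations).range.map proj)} =
      ((det₂ (X₁.a0, X₁.b0) (Y₁.a1, Y₁.b1)).natAbs *
        (det₂ (X₁.a0, X₁.b0) (Y₂.a0, Y₂.b0)).natAbs) ^ 4 := by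
  -- Modulo the centre `lift` is additive in the four noncentral coordinates, which shows that the
  -- image is free of rank `4`.
  let ψ : Multiplicative (Fin 4 → ℤ) →* Plane × Plane := MonoidHom.mk'
    (fun n => proj (lift h.relations ⟨n.toAdd 0, n.toAdd 1, n.toAdd 2, n.toAdd 3, 0, 0⟩)) (by
      intro n n'
      simp only [h.proj_lift]
      refine Prod.ext ?_ ?_ <;> refine congrArg Multiplicative.ofAdd ?_ <;>
        simp only [toAdd_mul, Pi.add_apply, toAdd_ofAdd] <;> module)
  have hψ : Function.Injective ψ := by
    rw [injective_iff_map_eq_one]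
    intro n hn
    obtain ⟨⟨h0, h2⟩, h1, h3⟩ := h.eq_zero_of_proj_lift hn
    refine Multiplicative.toAdd.injective (funext fun i => ?_)
    fin_cases i
    exacts [h0, h1, h2, h3]
  have hrange : ψ.range = (lift h.relations).range.map proj := by
    ext m
    constructor
    · rintro ⟨n, rfl⟩
      exact Subgroup.mem_map_of_mem _ ⟨_, rfl⟩
    · rintro ⟨_, ⟨g, rfl⟩, rfl⟩
      refine ⟨.ofAdd ![g.a0, g.a1, g.b0, g.b1], ?_⟩
      change proj _ = proj _
      rw [h.proj_lift, h.proj_lift]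
      rfl
  rw [h.derived_map_range, card_subgroup_fiber_of_range center_injective center_commute ker_proj _
    ψ hψ hrange, h.comap_center_range, AddSubgroup.index_toSubgroup,
    index_spanPair h.det_bracket_ne_zero, h.det_bracket, Int.natAbs_neg, Int.natAbs_mul]

end IsFrame
end Heis

/-! ### Subgroups with proportional lattices: structure, index and number -/

namespace Heis

/-- The subgroups whose projections to the two layers of the quotient modulo the centre are
proportional lattices and whose intersection with the centre is as small as possible. -/
structure IsProportional (p i l : ℕ) {m : ℕ} (τ : PrimitiveIndex p m) (D : Subgroup (Heis ℤ)) :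
    Prop where
  fst : (D.map proj).map (MonoidHom.fst _ _) = (scaledPrimitive p i τ).toSubgroup
  snd : (D.map proj).comap (MonoidHom.inr _ _) = (scaledPrimitive p l τ).toSubgroup
  center : D.comap center = derived (D.map proj)

section

variable {p i l m : ℕ} {τ : PrimitiveIndex p m}

theorem det_smul_smul {A : Type*} [CommRing A] (a b : A) (u v : A × A) :
    det₂ (a • u) (b • v) = a * b * det₂ u v := by
  simp [det₂]; ring

theorem natAbs_det_smul_primitive (i l : ℕ) (τ : PrimitiveIndex p m) :
    (det₂ ((p ^ i : ℤ) • primitiveFst p τ) ((p ^ l : ℤ) • primitiveSnd p τ)).natAbs =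
      p ^ (i + l + m) := by
  rw [det_smul_smul, Int.natAbs_mul, natAbs_det_primitive, Int.natAbs_mul, Int.natAbs_pow,
    Int.natAbs_pow, Int.natAbs_natCast, pow_add, pow_add]

/-- With a basis `u, v` of the primitive lattice, take `X₁, Y₂` above `p ^ i u, p ^ i v` and `X₂,
Y₁` in the `ε`-layer above `p ^ l u, p ^ l v`. Proportionality gives the relations. The product of
determinants, the index of the commutator lattice, is `p ^ (i + l + m) * p ^ (2 * i + m)`. -/
theorem exists_isFrame (hp : p.Prime) {D : Subgroup (Heis ℤ)}
    (h1 : (D.map proj).map (MonoidHom.fst _ _) = (scaledPrimitive p i τ).toSubgroup)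
    (h0 : (D.map proj).comap (MonoidHom.inr _ _) = (scaledPrimitive p l τ).toSubgroup) :
    ∃ (X₁ X₂ Y₁ Y₂ : Heis ℤ) (h : IsFrame X₁ X₂ Y₁ Y₂), (lift h.relations).range ≤ D ∧
      (lift h.relations).range.map proj = D.map proj ∧
      (det₂ (X₁.a0, X₁.b0) (Y₁.a1, Y₁.b1)).natAbs * (det₂ (X₁.a0, X₁.b0) (Y₂.a0, Y₂.b0)).natAbs =
        p ^ (3 * i + l + 2 * m) := by
  have hne (i l : ℕ) :
      det₂ ((p ^ i : ℤ) • primitiveFst p τ) ((p ^ l : ℤ) • primitiveSnd p τ) ≠ 0 := by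
    rw [← Int.natAbs_ne_zero, natAbs_det_smul_primitive]
    exact pow_ne_zero _ hp.ne_zero
  have ex1 {u : ℤ × ℤ} (hu : u ∈ scaledPrimitive p i τ) : ∃ X ∈ D, (X.a0, X.b0) = u := by
    have : Multiplicative.ofAdd u ∈ (D.map proj).map (MonoidHom.fst _ _) := by
      rw [h1]; exact hu
    obtain ⟨_, ⟨X, hX, rfl⟩, h⟩ := this
    exact ⟨X, hX, h⟩
  have ex0 {u : ℤ × ℤ} (hu : u ∈ scaledPrimitive p l τ) :
      ∃ X ∈ D, (X.a0 = 0 ∧ X.b0 = 0) ∧ (X.a1, X.b1) = u := by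
    have : Multiplicative.ofAdd u ∈ (D.map proj).comap (MonoidHom.inr _ _) := by
      rw [h0]; exact hu
    obtain ⟨X, hX, h⟩ := this
    exact ⟨X, hX, Prod.mk_eq_zero.1 (congrArg (fun m : Plane × Plane => m.1.toAdd) h),
      congrArg (fun m : Plane × Plane => m.2.toAdd) h⟩
  obtain ⟨X₁, hX₁, e1⟩ := ex1 (left_mem_spanPair _ _)
  obtain ⟨Y₂, hY₂, e4⟩ := ex1 (right_mem_spanPair _ _)
  obtain ⟨X₂, hX₂, e2', e2⟩ := ex0 (left_mem_spanPair _ _)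
  obtain ⟨Y₁, hY₁, e3', e3⟩ := ex0 (right_mem_spanPair _ _)
  have h : IsFrame X₁ X₂ Y₁ Y₂ := by
    refine ⟨e2'.1, e2'.2, e3'.1, e3'.2, ?_, ?_, ?_, ?_, ?_, ?_⟩
    · rw [e1, e2, det_smul_smul]; simp [det₂, mul_comm]
    · rw [e3, e4, det_smul_smul]; simp [det₂, mul_comm]
    · rw [e1, e2, e3, e4, det_smul_smul, det_smul_smul, mul_comm (p ^ i : ℤ)]
    · rw [e1, e4]; exact hne _ _
    · rw [e2, e3]; exact hne _ _
    · rw [e1, e3]; exact hne _ _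
  refine ⟨X₁, X₂, Y₁, Y₂, h, h.range_le hX₁ hX₂ hY₁ hY₂, h.map_proj_range
    (Subgroup.mem_map_of_mem _ hX₁) (Subgroup.mem_map_of_mem _ hX₂) (Subgroup.mem_map_of_mem _ hY₁)
    (Subgroup.mem_map_of_mem _ hY₂) ?_ ?_, ?_⟩
  · rw [e1, e4, h1]; rfl
  · rw [e2, e3, h0]; rfl
  · rw [e1, e3, e4, natAbs_det_smul_primitive, natAbs_det_smul_primitive, ← pow_add]
    congr 1; ring

/-- The frame spans a subgroup of `D` with the same image modulo the centre and, by minimality of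
the central layer, the same intersection with the centre. -/
theorem IsProportional.nonempty_mulEquiv (hp : p.Prime) {D : Subgroup (Heis ℤ)}
    (hD : IsProportional p i l τ D) : Nonempty (D ≃* Heis ℤ) := by
  obtain ⟨X₁, X₂, Y₁, Y₂, h, hle, hmap, -⟩ := exists_isFrame hp hD.fst hD.snd
  have : (lift h.relations).range = D := by
    refine subgroup_eq_of_le_of_map_eq ker_proj hle hmap ?_
    rw [hD.center, ← hmap, h.derived_map_range]
  exact ⟨((MonoidHom.ofInjective h.lift_injective).trans (MulEquiv.subgroupCongr this)).symm⟩

theorem IsProportional.index_eq (hp : p.Prime) {D : Subgroup (Heis ℤ)}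
    (hD : IsProportional p i l τ D) : D.index = p ^ (5 * i + 3 * l + 4 * m) := by
  obtain ⟨X₁, X₂, Y₁, Y₂, h, hle, hmap, hdet⟩ := exists_isFrame hp hD.fst hD.snd
  -- The three layers contribute the exponents `2 i + m`, `2 l + m` and `3 i + l + 2 m`.
  rw [index_eq_index_map_mul_index_comap center_commute ker_proj proj_surjective,
    index_eq_index_map_mul_index_comap inr_commute ker_fst_eq_range_inr
      (fun t => ⟨(t, 1), rfl⟩), hD.fst, hD.snd, hD.center, ← hmap, h.derived_map_range,
    h.comap_center_range, AddSubgroup.index_toSubgroup, AddSubgroup.index_toSubgroup,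
    AddSubgroup.index_toSubgroup, index_spanPair h.det_bracket_ne_zero, h.det_bracket,
    Int.natAbs_neg, Int.natAbs_mul, hdet, index_scaledPrimitive hp, index_scaledPrimitive hp,
    ← pow_add, ← pow_add]
  congr 1; ring

/-- The torsor count for `Plane × Plane` as an extension of `Plane` by `Plane`, with the product of
the two lattices as base point: rank `2` and index `p ^ (2 * l + m)`. -/
theorem card_subgroup_plane (hp : p.Prime) (i l : ℕ) (τ : PrimitiveIndex p m) :
    Nat.card {M : Subgroup (Plane × Plane) //
      M.map (MonoidHom.fst _ _) = (scaledPrimitive p i τ).toSubgroup ∧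
      M.comap (MonoidHom.inr _ _) = (scaledPrimitive p l τ).toSubgroup} =
      p ^ (2 * (2 * l + m)) := by
  have hfst : ((scaledPrimitive p i τ).toSubgroup.prod (scaledPrimitive p l τ).toSubgroup).map
      (MonoidHom.fst _ _) = (scaledPrimitive p i τ).toSubgroup := by
    ext t
    constructor
    · rintro ⟨m, hm, rfl⟩; exact hm.1
    · exact fun ht => ⟨(t, 1), ⟨ht, Subgroup.one_mem _⟩, rfl⟩
  have hsnd : ((scaledPrimitive p i τ).toSubgroup.prod (scaledPrimitive p l τ).toSubgroup).comap
      (MonoidHom.inr _ _) = (scaledPrimitive p l τ).toSubgroup := by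
    ext t
    constructor
    · exact fun h => h.2
    · exact fun ht => ⟨Subgroup.one_mem _, ht⟩
  have hdet : det₂ ((p ^ i : ℤ) • primitiveFst p τ) ((p ^ i : ℤ) • primitiveSnd p τ) ≠ 0 := by
    rw [← Int.natAbs_ne_zero, natAbs_det_smul_primitive]
    exact pow_ne_zero _ hp.ne_zero
  let ψ : Multiplicative (Fin 2 → ℤ) →* Plane := MonoidHom.mk'
    (fun n => .ofAdd (n.toAdd 0 • ((p ^ i : ℤ) • primitiveFst p τ) +
      n.toAdd 1 • ((p ^ i : ℤ) • primitiveSnd p τ))) (by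
      intro n n'
      refine congrArg Multiplicative.ofAdd ?_
      simp only [toAdd_mul, Pi.add_apply, toAdd_ofAdd]
      module)
  have hψ : Function.Injective ψ := by
    rw [injective_iff_map_eq_one]
    intro n hn
    obtain ⟨h0, h1⟩ := eq_zero_of_smul_add_smul_eq_zero hdet hn
    refine Multiplicative.toAdd.injective (funext fun i => ?_)
    fin_cases i
    exacts [h0, h1]
  have hrange : ψ.range = (scaledPrimitive p i τ).toSubgroup := by
    ext t
    constructor
    · rintro ⟨n, rfl⟩
      exact ⟨_, _, rfl⟩
    · rintro ⟨x, y, h⟩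
      exact ⟨.ofAdd ![x, y], h.symm⟩
  have := card_subgroup_fiber_of_range inr_injective inr_commute ker_fst_eq_range_inr
    ((scaledPrimitive p i τ).toSubgroup.prod (scaledPrimitive p l τ).toSubgroup) ψ hψ
    (by rw [hfst, hrange])
  rw [hfst, hsnd, AddSubgroup.index_toSubgroup, index_scaledPrimitive hp] at this
  rw [this, ← pow_mul]
  congr 1; ring

theorem card_isProportional (hp : p.Prime) (i l : ℕ) (τ : PrimitiveIndex p m) :
    Nat.card {D : Subgroup (Heis ℤ) // IsProportional p i l τ D} =
      p ^ (12 * i + 8 * l + 10 * m) := by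
  let S := {M : Subgroup (Plane × Plane) //
      M.map (MonoidHom.fst _ _) = (scaledPrimitive p i τ).toSubgroup ∧
      M.comap (MonoidHom.inr _ _) = (scaledPrimitive p l τ).toSubgroup}
  let e : {D : Subgroup (Heis ℤ) // IsProportional p i l τ D} ≃
      (Σ M : S, {D : Subgroup (Heis ℤ) // D.map proj = M.1 ∧ D.comap center = derived M.1}) :=
    { toFun := fun D => ⟨⟨D.1.map proj, D.2.fst, D.2.snd⟩, D.1, rfl, D.2.center⟩
      invFun := fun x => ⟨x.2.1, by rw [x.2.2.1]; exact x.1.2.1, by rw [x.2.2.1]; exact x.1.2.2,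
        by rw [x.2.2.1]; exact x.2.2.2⟩
      left_inv := fun _ => rfl
      right_inv := by
        rintro ⟨⟨M, hM⟩, D, hD, hD'⟩
        change D.map proj = M at hD
        subst hD
        rfl }
  have hfib (M : S) : Nat.card {D : Subgroup (Heis ℤ) // D.map proj = M.1 ∧
      D.comap center = derived M.1} = p ^ (4 * (3 * i + l + 2 * m)) := by
    obtain ⟨M, hM1, hM0⟩ := M
    -- `exists_isFrame` speaks of subgroups of the Heisenberg group, so `M` is replaced by its full
    -- preimage; the frame depends on the image only.
    have hM : (M.comap proj).map proj = M :=
      Subgroup.map_comap_eq_self_of_surjective proj_surjective M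
    rw [← hM] at hM1 hM0
    obtain ⟨X₁, X₂, Y₁, Y₂, h, -, hmap, hdet⟩ := exists_isFrame hp hM1 hM0
    rw [hM] at hmap
    have := h.card_fiber
    rw [hmap, hdet] at this
    rw [this, ← pow_mul]
    congr 1; ring
  have hS : Nat.card S = _ := card_subgroup_plane hp i l τ
  have hpos (n : ℕ) : p ^ n ≠ 0 := pow_ne_zero _ hp.ne_zero
  have : Finite S := Nat.finite_of_card_ne_zero (hS ▸ hpos _)
  have := Fintype.ofFinite S
  have (M : S) : Finite {D : Subgroup (Heis ℤ) // D.map proj = M.1 ∧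
      D.comap center = derived M.1} := Nat.finite_of_card_ne_zero (hfib M ▸ hpos _)
  rw [Nat.card_congr e, Nat.card_sigma, Finset.sum_congr rfl fun M _ => hfib M, Finset.sum_const,
    Finset.card_univ, ← Nat.card_eq_fintype_card, hS, smul_eq_mul, ← pow_add]
  congr 1; ring

end

/-- The triples of exponents that contribute to the subgroups of index `p ^ k`. -/
def exponents (k : ℕ) : Finset (ℕ × ℕ × ℕ) :=
  {x ∈ Finset.range (k + 1) ×ˢ Finset.range (k + 1) ×ˢ Finset.range (k + 1) |
    5 * x.1 + 3 * x.2.1 + 4 * x.2.2 = k}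

theorem mem_exponents {k : ℕ} {x : ℕ × ℕ × ℕ} :
    x ∈ exponents k ↔ 5 * x.1 + 3 * x.2.1 + 4 * x.2.2 = k := by
  simp only [exponents, Finset.mem_filter, Finset.mem_product, Finset.mem_range]
  omega

theorem ncard_isProportional {p : ℕ} (hp : p.Prime) (k : ℕ) :
    {D : Subgroup (Heis ℤ) | ∃ (i l m : ℕ) (τ : PrimitiveIndex p m),
      5 * i + 3 * l + 4 * m = k ∧ IsProportional p i l τ D}.ncard =
    ∑ x ∈ exponents k, Fintype.card (PrimitiveIndex p x.2.2) *
      p ^ (12 * x.1 + 8 * x.2.1 + 10 * x.2.2) := by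
  let F := Σ x : exponents k, Σ τ : PrimitiveIndex p x.1.2.2,
    {D : Subgroup (Heis ℤ) // IsProportional p x.1.1 x.1.2.1 τ D}
  have hfin (x : exponents k) (τ : PrimitiveIndex p x.1.2.2) :
      Finite {D : Subgroup (Heis ℤ) // IsProportional p x.1.1 x.1.2.1 τ D} :=
    Nat.finite_of_card_ne_zero
      (card_isProportional hp x.1.1 x.1.2.1 τ ▸ pow_ne_zero _ hp.ne_zero)
  have hcard : Nat.card F = ∑ x ∈ exponents k, Fintype.card (PrimitiveIndex p x.2.2) *
      p ^ (12 * x.1 + 8 * x.2.1 + 10 * x.2.2) := by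
    rw [Nat.card_sigma, ← Finset.sum_coe_sort (exponents k)]
    refine Finset.sum_congr rfl fun x _ => ?_
    rw [Nat.card_sigma, Finset.sum_congr rfl fun τ _ => card_isProportional hp x.1.1 x.1.2.1 τ,
      Finset.sum_const, smul_eq_mul, Finset.card_univ]
  rw [← hcard]
  symm
  refine Nat.card_eq_of_bijective
    (fun y => ⟨y.2.2.1, _, _, _, y.2.1, mem_exponents.1 y.1.2, y.2.2.2⟩) ⟨?_, ?_⟩
  · rintro ⟨⟨⟨i, l, m⟩, hx⟩, τ, D, hD⟩ ⟨⟨⟨i', l', m'⟩, hx'⟩, τ', D', hD'⟩ h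
    obtain rfl : D = D' := congrArg Subtype.val h
    have h1 := AddSubgroup.toSubgroup.injective (hD.fst.symm.trans hD'.fst)
    have h2 := AddSubgroup.toSubgroup.injective (hD.snd.symm.trans hD'.snd)
    obtain rfl : i = i' := scaledPrimitive_exponent_eq hp h1
    obtain rfl : l = l' := scaledPrimitive_exponent_eq hp h2
    -- With `i` and `l` recovered from the two lattices, `m` follows from the index.
    obtain rfl : m = m' := by
      rw [mem_exponents] at hx hx'
      simp only at hx hx'
      omega
    obtain rfl : τ = τ' := scaledPrimitive_injective hp h1
    rfl
  · rintro ⟨D, i, l, m, τ, hk, hD⟩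
    exact ⟨⟨⟨(i, l, m), mem_exponents.2 hk⟩, τ, D, hD⟩, rfl⟩

end Heis

/-! ### Formal power series in a power of the variable -/

section Series

open PowerSeries

variable {R : Type*} [CommRing R]

/-- The power series `∑ f n * X ^ (d * n)`. -/
def stretch (d : ℕ) (f : ℕ → R) : PowerSeries R :=
  PowerSeries.mk fun n => if d ∣ n then f (n / d) else 0

theorem coeff_stretch (d : ℕ) (f : ℕ → R) (n : ℕ) :
    PowerSeries.coeff n (stretch d f) = if d ∣ n then f (n / d) else 0 := PowerSeries.coeff_mk _ _

theorem one_sub_mul_stretch {d : ℕ} (hd : 0 < d) (α : R) (f : ℕ → R) :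
    (1 - PowerSeries.C α * PowerSeries.X ^ d) * stretch d f =
      stretch d (fun n => f n - if n = 0 then 0 else α * f (n - 1)) := by
  ext n
  rw [sub_mul, one_mul, mul_assoc, map_sub, PowerSeries.coeff_C_mul, PowerSeries.coeff_X_pow_mul',
    coeff_stretch, coeff_stretch, coeff_stretch]
  by_cases h : d ∣ n
  · obtain ⟨m, rfl⟩ := h
    rcases m with _ | m
    · simp [hd.ne']
    · have h1 : d ≤ d * (m + 1) := by nlinarith
      have h2 : d * (m + 1) - d = d * m := by rw [mul_add, mul_one, Nat.add_sub_cancel]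
      simp [h1, h2, Nat.mul_div_cancel_left _ hd]
  · have h1 : d ≤ n → ¬ d ∣ n - d := fun hle hdvd =>
      h (Nat.sub_add_cancel hle ▸ dvd_add hdvd dvd_rfl)
    by_cases hle : d ≤ n
    · simp [h, h1 hle]
    · simp [h, hle]

theorem stretch_zero_one {d : ℕ} (hd : 0 < d) (a b : R) :
    stretch d (fun n => if n = 0 then a else if n = 1 then b else 0) =
      PowerSeries.C a + PowerSeries.C b * PowerSeries.X ^ d := by
  ext n
  rw [coeff_stretch, map_add, PowerSeries.coeff_C, PowerSeries.coeff_C_mul, PowerSeries.coeff_X_pow]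
  by_cases h : d ∣ n
  · obtain ⟨m, rfl⟩ := h
    rw [if_pos (dvd_mul_right d m), Nat.mul_div_cancel_left _ hd]
    rcases m with _ | _ | m
    · simp [hd.ne]
    · simp [hd.ne']
    · have : d * (m + 1 + 1) ≠ d := by nlinarith
      simp [hd.ne', this]
  · have h1 : n ≠ 0 := by rintro rfl; exact h (dvd_zero _)
    have h2 : n ≠ d := by rintro rfl; exact h dvd_rfl
    simp [h, h1, h2]

theorem one_sub_mul_stretch_pow {d : ℕ} (hd : 0 < d) (α : R) :
    (1 - PowerSeries.C α * PowerSeries.X ^ d) * stretch d (fun n => α ^ n) = 1 := by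
  have : (fun n : ℕ => α ^ n - if n = 0 then 0 else α * α ^ (n - 1)) =
      fun n => if n = 0 then 1 else if n = 1 then 0 else 0 := by
    funext n
    rcases n with _ | n
    · simp
    · simp [pow_succ']
  rw [one_sub_mul_stretch hd, this, stretch_zero_one hd]
  simp

end Series

/-! ### The generating function of the counts -/

namespace Heis

theorem card_primitiveIndex (p m : ℕ) :
    Fintype.card (PrimitiveIndex p m) = p ^ m + if m = 0 then 0 else p ^ (m - 1) := by
  simp

/-- The number of subgroups of index `p ^ k` in the Heisenberg group that are counted by its
pro-isomorphic zeta function. -/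
def count (p k : ℕ) : ℕ :=
  ∑ x ∈ exponents k, Fintype.card (PrimitiveIndex p x.2.2) *
    p ^ (12 * x.1 + 8 * x.2.1 + 10 * x.2.2)

variable {R : Type*} [CommRing R]

/-- Both the index exponent and the summand split over `i`, `l` and `m`, so the generating function
is a product of three one-variable series. -/
theorem mk_count_eq_mul (p : ℕ) : PowerSeries.mk (fun k => (count p k : R)) =
    stretch 5 (fun n => ((p : R) ^ 12) ^ n) * (stretch 3 (fun n => ((p : R) ^ 8) ^ n) *
      stretch 4 (fun n => (Fintype.card (PrimitiveIndex p n) : R) * ((p : R) ^ 10) ^ n)) := by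
  ext k
  rw [PowerSeries.coeff_mk, PowerSeries.coeff_mul]
  simp_rw [PowerSeries.coeff_mul, Finset.mul_sum]
  rw [Finset.sum_sigma', count, Nat.cast_sum]
  refine Finset.sum_of_injOn (fun x => ⟨(5 * x.1, 3 * x.2.1 + 4 * x.2.2), (3 * x.2.1, 4 * x.2.2)⟩)
    ?_ ?_ ?_ ?_
  · rintro ⟨i, l, m⟩ - ⟨i', l', m'⟩ - h
    simp only [Sigma.mk.injEq, Prod.mk.injEq, heq_eq_eq] at h ⊢
    omega
  · rintro ⟨i, l, m⟩ h
    have := mem_exponents.1 h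
    dsimp only at this
    rw [SetLike.mem_coe, Finset.mem_sigma, Finset.HasAntidiagonal.mem_antidiagonal,
      Finset.HasAntidiagonal.mem_antidiagonal]
    exact ⟨by dsimp only; omega, rfl⟩
  · rintro ⟨⟨a, r⟩, b, c⟩ h hn
    simp only [Finset.mem_sigma, Finset.HasAntidiagonal.mem_antidiagonal] at h
    simp only [coeff_stretch]
    by_cases h5 : 5 ∣ a
    · by_cases h3 : 3 ∣ b
      · by_cases h4 : 4 ∣ c
        · obtain ⟨i, rfl⟩ := h5
          obtain ⟨l, rfl⟩ := h3
          obtain ⟨m, rfl⟩ := h4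
          refine (hn ⟨(i, l, m), ?_, ?_⟩).elim
          · rw [SetLike.mem_coe, mem_exponents]
            simp only
            omega
          · simp only [← h.2]
        · simp [h4]
      · simp [h3]
    · simp [h5]
  · rintro ⟨i, l, m⟩ -
    simp only [coeff_stretch, dvd_mul_right, if_true]
    rw [Nat.mul_div_cancel_left _ (by norm_num), Nat.mul_div_cancel_left _ (by norm_num),
      Nat.mul_div_cancel_left _ (by norm_num)]
    push_cast
    ring

/-- From `m = 1` on, the number of primitive lattices is multiplied by `p` at each step, so
multiplication by `1 - p ^ 11 X ^ 4` leaves only `m = 0` and `m = 1`, the latter with `(p + 1) p ^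
10 - p ^ 11 = p ^ 10`. -/
theorem one_sub_mul_stretch_card (p : ℕ) :
    (1 - PowerSeries.C ((p : R) ^ 11) * PowerSeries.X ^ 4) *
      stretch 4 (fun n => (Fintype.card (PrimitiveIndex p n) : R) * ((p : R) ^ 10) ^ n) =
      1 + PowerSeries.C ((p : R) ^ 10) * PowerSeries.X ^ 4 := by
  rw [one_sub_mul_stretch (by norm_num), ← (PowerSeries.C (R := R)).map_one,
    ← stretch_zero_one (by norm_num)]
  congr 1
  funext n
  simp only [card_primitiveIndex]
  rcases n with _ | _ | n
  · simp
  · simp; ring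
  · simp; ring

theorem mk_count_eq (p : ℕ) : PowerSeries.mk (fun k => (count p k : R)) =
    (1 + PowerSeries.C ((p : R) ^ 10) * PowerSeries.X ^ 4) *
      (stretch 3 (fun n => ((p : R) ^ 8) ^ n) * stretch 4 (fun n => ((p : R) ^ 11) ^ n) *
        stretch 5 (fun n => ((p : R) ^ 12) ^ n)) := by
  rw [mk_count_eq_mul, ← one_sub_mul_stretch_card]
  linear_combination -(stretch 5 (fun n => ((p : R) ^ 12) ^ n) *
    (stretch 3 (fun n => ((p : R) ^ 8) ^ n) *
      stretch 4 (fun n => (Fintype.card (PrimitiveIndex p n) : R) * ((p : R) ^ 10) ^ n))) *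
    one_sub_mul_stretch_pow (d := 4) (by norm_num) ((p : R) ^ 11)

theorem mul_mk_count (p : ℕ) :
    (1 - PowerSeries.C ((p : R) ^ 8) * PowerSeries.X ^ 3) *
      (1 - PowerSeries.C ((p : R) ^ 11) * PowerSeries.X ^ 4) *
      (1 - PowerSeries.C ((p : R) ^ 12) * PowerSeries.X ^ 5) *
      PowerSeries.mk (fun k => (count p k : R)) =
    1 + PowerSeries.C ((p : R) ^ 10) * PowerSeries.X ^ 4 := by
  have h3 := one_sub_mul_stretch_pow (d := 3) (by norm_num) ((p : R) ^ 8)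
  have h4 := one_sub_mul_stretch_pow (d := 4) (by norm_num) ((p : R) ^ 11)
  have h5 := one_sub_mul_stretch_pow (d := 5) (by norm_num) ((p : R) ^ 12)
  rw [mk_count_eq]
  calc _ = (1 + PowerSeries.C ((p : R) ^ 10) * PowerSeries.X ^ 4) *
        (((1 - PowerSeries.C ((p : R) ^ 8) * PowerSeries.X ^ 3) *
          stretch 3 (fun n => ((p : R) ^ 8) ^ n)) *
        ((1 - PowerSeries.C ((p : R) ^ 11) * PowerSeries.X ^ 4) *
          stretch 4 (fun n => ((p : R) ^ 11) ^ n)) *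
        ((1 - PowerSeries.C ((p : R) ^ 12) * PowerSeries.X ^ 5) *
          stretch 5 (fun n => ((p : R) ^ 12) ^ n))) := by ring
    _ = _ := by rw [h3, h4, h5]; ring

end Heis

/-! ### Absolute convergence -/

section Analytic

/-- The power series `F` converges absolutely at `t` with sum `v`. -/
def HasAbsSum (F : PowerSeries ℂ) (t v : ℂ) : Prop :=
  Summable (fun n => ‖PowerSeries.coeff n F * t ^ n‖) ∧
    HasSum (fun n => PowerSeries.coeff n F * t ^ n) v

theorem HasAbsSum.mul {F G : PowerSeries ℂ} {t v w : ℂ} (hF : HasAbsSum F t v)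
    (hG : HasAbsSum G t w) : HasAbsSum (F * G) t (v * w) := by
  have key : (fun n => PowerSeries.coeff n (F * G) * t ^ n) = fun n =>
      ∑ kl ∈ Finset.HasAntidiagonal.antidiagonal n,
        (PowerSeries.coeff kl.1 F * t ^ kl.1) * (PowerSeries.coeff kl.2 G * t ^ kl.2) := by
    funext n
    rw [PowerSeries.coeff_mul, Finset.sum_mul]
    refine Finset.sum_congr rfl fun kl hkl => ?_
    rw [← Finset.HasAntidiagonal.mem_antidiagonal.1 hkl, pow_add]
    ring
  have h1 := summable_norm_sum_mul_antidiagonal_of_summable_norm hF.1 hG.1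
  have h2 := tsum_mul_tsum_eq_tsum_sum_antidiagonal_of_summable_norm hF.1 hG.1
  rw [hF.2.tsum_eq, hG.2.tsum_eq] at h2
  simp_rw [HasAbsSum, congrFun key]
  exact ⟨h1, h2 ▸ h1.of_norm.hasSum⟩

theorem hasAbsSum_stretch {d : ℕ} (hd : 0 < d) {f : ℕ → ℂ} {t v : ℂ}
    (h1 : Summable (fun n => ‖f n * (t ^ d) ^ n‖)) (h2 : HasSum (fun n => f n * (t ^ d) ^ n) v) :
    HasAbsSum (stretch d f) t v := by
  have hinj : Function.Injective (fun n : ℕ => d * n) := fun a b h => Nat.eq_of_mul_eq_mul_left hd h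
  have hout (n : ℕ) (hn : n ∉ Set.range (fun n : ℕ => d * n)) :
      PowerSeries.coeff n (stretch d f) * t ^ n = 0 := by
    rw [coeff_stretch, if_neg, zero_mul]
    rintro ⟨m, rfl⟩
    exact hn ⟨m, rfl⟩
  have hcomp (n : ℕ) : PowerSeries.coeff (d * n) (stretch d f) * t ^ (d * n) =
      f n * (t ^ d) ^ n := by
    rw [coeff_stretch, if_pos (dvd_mul_right d n), Nat.mul_div_cancel_left _ hd, pow_mul]
  constructor
  · rw [← hinj.summable_iff (fun n hn => by rw [hout n hn, norm_zero])]
    simpa only [Function.comp_def, hcomp] using h1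
  · rw [← hinj.hasSum_iff hout]
    simpa only [Function.comp_def, hcomp] using h2

theorem hasAbsSum_stretch_pow {d : ℕ} (hd : 0 < d) {α t : ℂ} (h : ‖α * t ^ d‖ < 1) :
    HasAbsSum (stretch d (fun n => α ^ n)) t (1 - α * t ^ d)⁻¹ := by
  refine hasAbsSum_stretch hd ?_ ?_
  · simp_rw [← mul_pow, norm_pow]
    exact summable_geometric_of_lt_one (norm_nonneg _) h
  · simp_rw [← mul_pow]
    exact hasSum_geometric_of_norm_lt_one h

theorem hasAbsSum_one_add {d : ℕ} (hd : 0 < d) (b t : ℂ) :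
    HasAbsSum (1 + PowerSeries.C b * PowerSeries.X ^ d) t (1 + b * t ^ d) := by
  rw [← (PowerSeries.C (R := ℂ)).map_one, ← stretch_zero_one hd]
  have hz (n : ℕ) (hn : n ∉ Finset.range 2) :
      (if n = 0 then (1 : ℂ) else if n = 1 then b else 0) * (t ^ d) ^ n = 0 := by
    have h0 : n ≠ 0 := by rintro rfl; simp at hn
    have h1 : n ≠ 1 := by rintro rfl; simp at hn
    simp [h0, h1]
  refine hasAbsSum_stretch hd
    (summable_of_ne_finset_zero (s := Finset.range 2) fun n hn => by rw [hz n hn, norm_zero]) ?_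
  have := hasSum_sum_of_ne_finset_zero (L := .unconditional ℕ) (s := Finset.range 2) hz
  simpa [Finset.sum_range_succ] using this

namespace Heis

theorem hasAbsSum_count {p : ℕ} (hp : p.Prime) {s : ℂ} (hs : 11 / 4 < s.re) :
    HasAbsSum (PowerSeries.mk fun k => (count p k : ℂ)) ((p : ℂ) ^ (-s))
      ((1 + (p : ℂ) ^ (10 - 4 * s)) /
          ((1 - (p : ℂ) ^ (8 - 3 * s)) * (1 - (p : ℂ) ^ (11 - 4 * s)) *
            (1 - (p : ℂ) ^ (12 - 5 * s)))) := by
  have hp0 : (p : ℂ) ≠ 0 := by exact_mod_cast hp.ne_zero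
  have hpow (a d : ℕ) : (p : ℂ) ^ a * ((p : ℂ) ^ (-s)) ^ d = (p : ℂ) ^ ((a : ℂ) - d * s) := by
    rw [← Complex.cpow_nat_mul, ← Complex.cpow_natCast, ← Complex.cpow_add _ _ hp0]
    congr 1; ring
  have hnorm (a d : ℕ) (h : (a : ℝ) < d * s.re) :
      ‖(p : ℂ) ^ a * ((p : ℂ) ^ (-s)) ^ d‖ < 1 := by
    rw [hpow, Complex.norm_natCast_cpow_of_pos hp.pos]
    refine Real.rpow_lt_one_of_one_lt_of_neg (by exact_mod_cast hp.one_lt) ?_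
    simpa using h
  -- The three factors need `Re s` larger than `8 / 3`, `11 / 4` and `12 / 5`; the middle bound is
  -- the largest.
  have h3 := hasAbsSum_stretch_pow (d := 3) (by norm_num) (hnorm 8 3 (by norm_num; linarith))
  have h4 := hasAbsSum_stretch_pow (d := 4) (by norm_num) (hnorm 11 4 (by norm_num; linarith))
  have h5 := hasAbsSum_stretch_pow (d := 5) (by norm_num) (hnorm 12 5 (by norm_num; linarith))
  have hN := hasAbsSum_one_add (d := 4) (by norm_num) ((p : ℂ) ^ 10) ((p : ℂ) ^ (-s))
  rw [hpow] at h3 h4 h5 hN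
  rw [mk_count_eq, div_eq_mul_inv, mul_inv, mul_inv]
  exact_mod_cast hN.mul ((h3.mul h4).mul h5)

end Heis

end Analytic

/-! ### Profinite completions -/

section Completion

open CategoryTheory ProfiniteGrp ProfiniteCompletion

/-- Isomorphic groups have isomorphic profinite completions. -/
noncomputable def completionCongr {G H : Type} [Group G] [Group H] (e : G ≃* H) :
    completion (GrpCat.of G) ≃ₜ* completion (GrpCat.of H) :=
  let i := profiniteCompletion.mapIso e.toGrpIso
  { toFun := i.hom.hom
    invFun := i.inv.hom
    left_inv := fun x => ProfiniteGrp.inv_hom_apply i x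
    right_inv := fun x => ProfiniteGrp.hom_inv_apply i x
    map_mul' := map_mul i.hom.hom
    continuous_toFun := i.hom.hom.continuous_toFun
    continuous_invFun := i.inv.hom.continuous_toFun }

theorem closure_range_comp_etaFn {G P : Type} [Group G] [TopologicalSpace P] [T2Space P]
    {φ : completion (GrpCat.of G) → P} (hφ : Continuous φ) :
    closure (Set.range fun g : G => φ (etaFn (GrpCat.of G) g)) = Set.range φ := by
  have h := hφ.isClosedMap.closure_image_eq_of_continuous hφ (Set.range (etaFn (GrpCat.of G)))
  rw [(denseRange (GrpCat.of G)).closure_range, Set.image_univ, ← Set.range_comp] at h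
  exact h

/-- By the universal property `j` extends to the completion of `H`; composing with `e⁻¹` and
restricting to `G` gives `τ`. Both closures are the image of the whole completion, because a group
is dense in its completion. This is the only consequence of the isomorphism of completions that is
used. -/
theorem exists_monoidHom_closure_range_eq {G H P : Type} [Group G] [Group H] [Group P]
    [TopologicalSpace P] [IsTopologicalGroup P] [CompactSpace P] [TotallyDisconnectedSpace P]
    (e : completion (GrpCat.of H) ≃ₜ* completion (GrpCat.of G)) (j : H →* P) :
    ∃ τ : G →* P, closure (Set.range τ) = closure (Set.range j) := by
  have : T2Space P := (ProfiniteGrp.of P).toProfinite.is_hausdorff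
  let f : GrpCat.of H ⟶ GrpCat.of (ProfiniteGrp.of P) := GrpCat.ofHom j
  let φ := (lift f).hom
  have hφ (h : H) : φ (etaFn (GrpCat.of H) h) = j h :=
    ConcreteCategory.congr_hom (lift_eta f) h
  have hφc : Continuous φ := φ.continuous_toFun
  refine ⟨(φ.toMonoidHom.comp e.symm.toMulEquiv.toMonoidHom).comp (eta (GrpCat.of G)).hom, ?_⟩
  have h1 := closure_range_comp_etaFn (G := G) (φ := fun x => φ (e.symm x))
    (hφc.comp e.symm.continuous_toFun)
  have h2 := closure_range_comp_etaFn (G := H) hφc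
  simp_rw [hφ] at h2
  have h3 : Set.range (fun x => φ (e.symm x)) = Set.range φ :=
    e.symm.surjective.range_comp φ
  rw [← h3, ← h1] at h2
  exact h2.symm

end Completion

/-! ### Topology, subgroups of finite index and `p`-adic approximation -/

namespace Heis

section Topology

variable {A : Type*}

/-- The coordinates of an element of the Heisenberg group. -/
def toProd : Heis A ≃ A × A × A × A × A × A where
  toFun g := (g.a0, g.a1, g.b0, g.b1, g.c0, g.c1)
  invFun x := ⟨x.1, x.2.1, x.2.2.1, x.2.2.2.1, x.2.2.2.2.1, x.2.2.2.2.2⟩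
  left_inv _ := rfl
  right_inv _ := rfl

variable [TopologicalSpace A]

instance : TopologicalSpace (Heis A) := .induced toProd inferInstance

/-- The coordinates of an element of the Heisenberg group, as a homeomorphism. -/
def homeoProd : Heis A ≃ₜ A × A × A × A × A × A :=
  toProd.toHomeomorphOfIsInducing ⟨rfl⟩

instance [CompactSpace A] : CompactSpace (Heis A) := homeoProd.symm.compactSpace

instance [TotallyDisconnectedSpace A] : TotallyDisconnectedSpace (Heis A) :=
  homeoProd.symm.totallyDisconnectedSpace

instance [T2Space A] : T2Space (Heis A) := homeoProd.symm.t2Space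

@[fun_prop] theorem continuous_a0 : Continuous (a0 : Heis A → A) :=
  continuous_fst.comp homeoProd.continuous
@[fun_prop] theorem continuous_a1 : Continuous (a1 : Heis A → A) :=
  (continuous_fst.comp continuous_snd).comp homeoProd.continuous
@[fun_prop] theorem continuous_b0 : Continuous (b0 : Heis A → A) :=
  (continuous_fst.comp (continuous_snd.comp continuous_snd)).comp homeoProd.continuous
@[fun_prop] theorem continuous_b1 : Continuous (b1 : Heis A → A) :=
  (continuous_fst.comp (continuous_snd.comp (continuous_snd.comp continuous_snd))).comp
    homeoProd.continuous
@[fun_prop] theorem continuous_c0 : Continuous (c0 : Heis A → A) :=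
  (continuous_fst.comp (continuous_snd.comp (continuous_snd.comp
    (continuous_snd.comp continuous_snd)))).comp homeoProd.continuous
@[fun_prop] theorem continuous_c1 : Continuous (c1 : Heis A → A) :=
  (continuous_snd.comp (continuous_snd.comp (continuous_snd.comp
    (continuous_snd.comp continuous_snd)))).comp homeoProd.continuous

theorem continuous_of_coordinates {B : Type*} [TopologicalSpace B] {φ : B → Heis A}
    (h0 : Continuous fun x => (φ x).a0) (h1 : Continuous fun x => (φ x).a1)
    (h2 : Continuous fun x => (φ x).b0) (h3 : Continuous fun x => (φ x).b1)
    (h4 : Continuous fun x => (φ x).c0) (h5 : Continuous fun x => (φ x).c1) : Continuous φ :=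
  homeoProd.comp_continuous_iff.1
    (h0.prodMk (h1.prodMk (h2.prodMk (h3.prodMk (h4.prodMk h5)))))

instance {A : Type*} [CommRing A] [TopologicalSpace A] [IsTopologicalRing A] :
    IsTopologicalGroup (Heis A) where
  continuous_mul := by
    apply continuous_of_coordinates <;> simp only [mul_a0, mul_a1, mul_b0, mul_b1, mul_c0, mul_c1]
      <;> fun_prop
  continuous_inv := by
    apply continuous_of_coordinates <;> simp only [inv_a0, inv_a1, inv_b0, inv_b1, inv_c0, inv_c1]
      <;> fun_prop

end Topology

section Index

/-- For a normal subgroup this is Lagrange. Here `D` is normal in its product with the kernel, since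
the kernel is central, and that product is normal because `Q` is commutative; the two exponents
multiply to the index. -/
theorem pow_index_mem_of_central {G Q : Type*} [Group G] [CommGroup Q] (f : G →* Q)
    (hf : ∀ c ∈ f.ker, ∀ g, Commute c g) (D : Subgroup G) (g : G) : g ^ D.index ∈ D := by
  have hle : D ≤ (D.map f).comap f := Subgroup.le_comap_map f D
  have hnorm : (D.map f).comap f ≤ Subgroup.normalizer (D : Set G) := by
    intro s hs
    obtain ⟨d, hd, h⟩ := hs
    have hc : d⁻¹ * s ∈ f.ker := by simp [MonoidHom.mem_ker, h]
    rw [Subgroup.mem_normalizer_iff]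
    intro x
    have : s * x * s⁻¹ = d * x * d⁻¹ := by
      have hs' : s = d * (d⁻¹ * s) := by group
      have hx := (hf _ hc x).eq
      generalize d⁻¹ * s = c at hx hs'
      rw [hs', mul_assoc d c x, hx]
      group
    rw [this]
    constructor
    · exact fun hx => D.mul_mem (D.mul_mem hd hx) (D.inv_mem hd)
    · intro hx
      convert D.mul_mem (D.mul_mem (D.inv_mem hd) hx) hd using 1
      group
  have := Subgroup.normal_subgroupOf_of_le_normalizer hnorm
  have h1 : g ^ ((D.map f).comap f).index ∈ (D.map f).comap f := Subgroup.pow_index_mem _ g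
  have h2 := Subgroup.pow_index_mem (D.subgroupOf ((D.map f).comap f)) ⟨_, h1⟩
  rw [← Subgroup.relIndex_mul_index hle, mul_comm, pow_mul]
  exact h2

theorem pow_index_mem (D : Subgroup (Heis ℤ)) (g : Heis ℤ) : g ^ D.index ∈ D :=
  pow_index_mem_of_central proj (fun c hc => by
    rw [ker_proj] at hc
    obtain ⟨t, rfl⟩ := hc
    exact center_commute t) D g

theorem mem_of_dvd {D : Subgroup (Heis ℤ)} {g : Heis ℤ} (h0 : (D.index : ℤ) ∣ g.a0)
    (h1 : (D.index : ℤ) ∣ g.a1) (h2 : (D.index : ℤ) ∣ g.b0) (h3 : (D.index : ℤ) ∣ g.b1)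
    (h4 : (D.index : ℤ) ∣ g.c0) (h5 : (D.index : ℤ) ∣ g.c1) : g ∈ D := by
  have key (x : Heis ℤ) {n : ℤ} (h : (D.index : ℤ) ∣ n) : x ^ n ∈ D := by
    obtain ⟨c, rfl⟩ := h
    rw [zpow_mul, zpow_natCast]
    exact D.zpow_mem (pow_index_mem D x) c
  rw [eq_mul_zpow g]
  exact D.mul_mem (D.mul_mem (D.mul_mem (key _ h2) (key _ h3)) (D.mul_mem (key _ h0) (key _ h1)))
    (D.mul_mem (key _ h4) (key _ h5))

/-- A subgroup of index `n` contains the kernel of reduction modulo `n`, so it is determined by its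
image in a finite group. -/
theorem finite_setOf_index_eq {n : ℕ} (hn : 0 < n) :
    {D : Subgroup (Heis ℤ) | D.index = n}.Finite := by
  have : NeZero n := ⟨hn.ne'⟩
  have : Finite (Heis (ZMod n)) := Finite.of_injective _ (toProd (A := ZMod n)).injective
  have hfin : Finite (Subgroup (Heis (ZMod n))) := inferInstance
  refine Set.Finite.of_finite_image (f := Subgroup.map (map (Int.castRingHom (ZMod n))))
    (Set.toFinite _) ?_
  have key (D : Subgroup (Heis ℤ)) (hD : D.index = n) :
      (D.map (map (Int.castRingHom (ZMod n)))).comap (map (Int.castRingHom (ZMod n))) = D := by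
    refine Subgroup.comap_map_eq_self fun g hg => ?_
    have hd {z : ℤ} (hz : Int.castRingHom (ZMod n) z = 0) : (D.index : ℤ) ∣ z := by
      rw [hD]; exact (ZMod.intCast_zmod_eq_zero_iff_dvd z n).1 hz
    exact mem_of_dvd (hd (congrArg a0 hg)) (hd (congrArg a1 hg)) (hd (congrArg b0 hg))
      (hd (congrArg b1 hg)) (hd (congrArg c0 hg)) (hd (congrArg c1 hg))
  intro D hD D' hD' h
  rw [← key D hD, ← key D' hD']
  exact congrArg _ h

end Index

section Approximation

variable {p : ℕ} [Fact p.Prime]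

/-- The inclusion of the integral Heisenberg group into the `p`-adic one. -/
noncomputable abbrev padic (p : ℕ) [Fact p.Prime] : Heis ℤ →* Heis ℤ_[p] :=
  map (Int.castRingHom ℤ_[p])

/-- Congruence of elements of the `p`-adic Heisenberg group modulo `p ^ n`. -/
structure Congruent (n : ℕ) (X Y : Heis ℤ_[p]) : Prop where
  a0 : (p : ℤ_[p]) ^ n ∣ X.a0 - Y.a0
  a1 : (p : ℤ_[p]) ^ n ∣ X.a1 - Y.a1
  b0 : (p : ℤ_[p]) ^ n ∣ X.b0 - Y.b0
  b1 : (p : ℤ_[p]) ^ n ∣ X.b1 - Y.b1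

theorem isOpen_setOf_dvd_sub (n : ℕ) (x : ℤ_[p]) :
    IsOpen {y : ℤ_[p] | (p : ℤ_[p]) ^ n ∣ x - y} := by
  have hp : (p : ℝ) ≠ 0 := by exact_mod_cast (Fact.out : p.Prime).ne_zero
  have : {y : ℤ_[p] | (p : ℤ_[p]) ^ n ∣ x - y} = Metric.closedBall x ((p : ℝ) ^ (-(n : ℤ))) := by
    ext y
    rw [Metric.mem_closedBall, dist_comm, dist_eq_norm, PadicInt.norm_le_pow_iff_mem_span_pow,
      Ideal.mem_span_singleton]
    rfl
  rw [this]
  exact IsUltrametricDist.isOpen_closedBall x (zpow_ne_zero _ hp)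

theorem exists_congruent {D : Subgroup (Heis ℤ)} {X : Heis ℤ_[p]}
    (hX : X ∈ closure (padic p '' D)) (n : ℕ) : ∃ g ∈ D, Congruent n X (padic p g) := by
  have hopen : IsOpen {Y : Heis ℤ_[p] | Congruent n X Y} := by
    have : {Y : Heis ℤ_[p] | Congruent n X Y} =
        a0 ⁻¹' {y | (p : ℤ_[p]) ^ n ∣ X.a0 - y} ∩ a1 ⁻¹' {y | (p : ℤ_[p]) ^ n ∣ X.a1 - y} ∩
        (b0 ⁻¹' {y | (p : ℤ_[p]) ^ n ∣ X.b0 - y} ∩ b1 ⁻¹' {y | (p : ℤ_[p]) ^ n ∣ X.b1 - y}) := by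
      ext Y
      exact ⟨fun h => ⟨⟨h.a0, h.a1⟩, h.b0, h.b1⟩, fun h => ⟨h.1.1, h.1.2, h.2.1, h.2.2⟩⟩
    rw [this]
    exact (((isOpen_setOf_dvd_sub n _).preimage continuous_a0).inter
      ((isOpen_setOf_dvd_sub n _).preimage continuous_a1)).inter
      (((isOpen_setOf_dvd_sub n _).preimage continuous_b0).inter
      ((isOpen_setOf_dvd_sub n _).preimage continuous_b1))
  obtain ⟨_, hY, g, hg, rfl⟩ := mem_closure_iff.1 hX _ hopen
    ⟨by simp, by simp, by simp, by simp⟩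
  exact ⟨g, hg, hY⟩

/-- Every element of the source is a product of powers of the six generators. Allowing `p`-adic
exponents `n`, with `q` tied to `n` by a closed condition, gives a compact, hence closed, set that
contains the image. -/
theorem exists_formalPow_of_mem_closure (τ : Heis ℤ →* Heis ℤ_[p]) {Y : Heis ℤ_[p]}
    (hY : Y ∈ closure (Set.range τ)) :
    ∃ n q : Fin 6 → ℤ_[p], (∀ i, 2 * q i = n i * (n i - 1)) ∧
      Y = (τ (y₂ ℤ)).formalPow (n 0) (q 0) * (τ (y₁ ℤ)).formalPow (n 1) (q 1) *
        ((τ (x₁ ℤ)).formalPow (n 2) (q 2) * (τ (x₂ ℤ)).formalPow (n 3) (q 3)) *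
        ((τ (f ℤ)).formalPow (n 4) (q 4) * (τ (e ℤ)).formalPow (n 5) (q 5)) := by
  let K : Set ((Fin 6 → ℤ_[p]) × (Fin 6 → ℤ_[p])) :=
    {x | ∀ i, 2 * x.2 i = x.1 i * (x.1 i - 1)}
  let Φ : (Fin 6 → ℤ_[p]) × (Fin 6 → ℤ_[p]) → Heis ℤ_[p] := fun x =>
    (τ (y₂ ℤ)).formalPow (x.1 0) (x.2 0) * (τ (y₁ ℤ)).formalPow (x.1 1) (x.2 1) *
        ((τ (x₁ ℤ)).formalPow (x.1 2) (x.2 2) * (τ (x₂ ℤ)).formalPow (x.1 3) (x.2 3)) *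
        ((τ (f ℤ)).formalPow (x.1 4) (x.2 4) * (τ (e ℤ)).formalPow (x.1 5) (x.2 5))
  have hK : IsCompact K := by
    refine IsClosed.isCompact ?_
    simp only [K, Set.ofPred_forall]
    exact isClosed_iInter fun i => isClosed_eq (by fun_prop) (by fun_prop)
  have hpow (X : Heis ℤ_[p]) (i : Fin 6) :
      Continuous fun x : (Fin 6 → ℤ_[p]) × (Fin 6 → ℤ_[p]) => X.formalPow (x.1 i) (x.2 i) := by
    apply continuous_of_coordinates <;> simp only [formalPow] <;> fun_prop
  have hΦ : Continuous Φ :=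
    (((hpow _ 0).mul (hpow _ 1)).mul ((hpow _ 2).mul (hpow _ 3))).mul
      ((hpow _ 4).mul (hpow _ 5))
  have hsub : Set.range τ ⊆ Φ '' K := by
    rintro _ ⟨g, rfl⟩
    choose q hq h using fun n : ℤ => exists_zpow_eq_formalPow (A := ℤ_[p]) n
    let n : Fin 6 → ℤ := ![g.b0, g.b1, g.a0, g.a1, g.c0, g.c1]
    refine ⟨(fun i => n i, fun i => q (n i)), fun i => ?_, ?_⟩
    · have := congrArg (Int.cast : ℤ → ℤ_[p]) (hq (n i))
      push_cast at this
      exact this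
    simp only [Φ, ← h]
    conv_rhs => rw [eq_mul_zpow g]
    simp only [map_mul, map_zpow]
    rfl
  obtain ⟨⟨n, q⟩, hnq, rfl⟩ := closure_minimal hsub (hK.image hΦ).isClosed hY
  exact ⟨n, q, hnq, rfl⟩

end Approximation

end Heis

/-! ### Proportionality of lattices from determinant relations -/

theorem det₂_smul_eq {A : Type*} [CommRing A] (u v w : A × A) :
    det₂ u w • v = det₂ u v • w + det₂ v w • u := by
  ext <;> simp [det₂] <;> ring

/-- If `u₂ ≠ 0`, then `u₁` and `u₃` are both parallel to it, so `det₂ u₁ u₃ = det₂ u₂ u₄ = 0`; then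
`u₄` is parallel to it as well and `det₂ u₁ u₄ = 0`, contrary to `hne`. The argument for `u₃` is
symmetric. -/
theorem eq_zero_and_eq_zero_of_det {A : Type*} [CommRing A] [IsDomain A] {u₁ u₂ u₃ u₄ : A × A}
    (h12 : det₂ u₁ u₂ = 0) (h34 : det₂ u₃ u₄ = 0) (h23 : det₂ u₂ u₃ = 0)
    (h13 : det₂ u₁ u₃ = det₂ u₂ u₄)
    (hne : ¬ (det₂ u₁ u₃ = 0 ∧ det₂ u₁ u₄ = 0)) : u₂ = 0 ∧ u₃ = 0 := by
  constructor
  · by_contra h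
    have h1 : det₂ u₁ u₃ = 0 := by
      have := det₂_smul_eq u₁ u₂ u₃
      rw [h12, h23, zero_smul, zero_smul, add_zero] at this
      exact (smul_eq_zero.1 this).resolve_right h
    have h2 : det₂ u₁ u₄ = 0 := by
      have := det₂_smul_eq u₁ u₂ u₄
      rw [h12, ← h13, h1, zero_smul, zero_smul, add_zero] at this
      exact (smul_eq_zero.1 this).resolve_right h
    exact hne ⟨h1, h2⟩
  · by_contra h
    have h1 : det₂ u₂ u₄ = 0 := by
      have := det₂_smul_eq u₂ u₃ u₄
      rw [h23, h34, zero_smul, zero_smul, add_zero] at this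
      exact (smul_eq_zero.1 this).resolve_right h
    have h2 : det₂ u₁ u₄ = 0 := by
      have := det₂_smul_eq u₁ u₃ u₄
      rw [h13, h1, h34, zero_smul, zero_smul, add_zero] at this
      exact (smul_eq_zero.1 this).resolve_right h
    exact hne ⟨h13.trans h1, h2⟩

/-- Lattices in `ℤ²` that become equal after multiplication by powers of `p` are multiples of the
same primitive lattice. -/
theorem exists_scaledPrimitive_of_smul_eq {p n x y : ℕ} (hp : p.Prime)
    {L₁ L₀ : AddSubgroup (ℤ × ℤ)} (hL : ∀ w : ℤ × ℤ, (p ^ n : ℤ) • w ∈ L₁)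
    (h01 : ∀ w ∈ L₀, ∃ v ∈ L₁, (p ^ x : ℤ) • w = (p ^ y : ℤ) • v)
    (h10 : ∀ v ∈ L₁, ∃ w ∈ L₀, (p ^ x : ℤ) • w = (p ^ y : ℤ) • v) :
    ∃ (i l m : ℕ) (τ : PrimitiveIndex p m),
      L₁ = scaledPrimitive p i τ ∧ L₀ = scaledPrimitive p l τ := by
  have hp0 : (p : ℤ) ≠ 0 := by exact_mod_cast hp.ne_zero
  have hpow (a : ℕ) : (p ^ a : ℤ) ≠ 0 := pow_ne_zero _ hp0
  obtain ⟨i, m, τ, hτ⟩ := exists_eq_scaledPrimitive hp hL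
  -- Otherwise `p` would divide every vector of the primitive lattice. The exponent of `L₀` is then
  -- `l = y + i - x`.
  have hx : x ≤ y + i := by
    by_contra! hlt
    obtain ⟨k, rfl⟩ := Nat.exists_eq_add_of_lt hlt
    obtain ⟨w, hw, hw'⟩ := exists_mem_primitive_not_dvd hp τ
    have hmem : (p ^ i : ℤ) • w ∈ L₁ := hτ ▸ mem_scaledPrimitive.2 ⟨w, hw, rfl⟩
    obtain ⟨v, -, hv⟩ := h10 _ hmem
    have hv' : (p ^ (y + i) : ℤ) • ((p ^ (k + 1) : ℤ) • v) = (p ^ (y + i) : ℤ) • w := by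
      rw [smul_smul, ← pow_add, ← add_assoc, hv, smul_smul, ← pow_add]
    have h := smul_right_injective _ (hpow _) hv'
    refine hw' (h ▸ ⟨?_, ?_⟩) <;>
      exact Dvd.dvd.mul_right (dvd_pow_self _ (Nat.succ_ne_zero _)) _
  obtain ⟨l, hl⟩ := Nat.exists_eq_add_of_le hx
  have hscale (w : ℤ × ℤ) : (p ^ x : ℤ) • ((p ^ l : ℤ) • w) = (p ^ y : ℤ) • ((p ^ i : ℤ) • w) := by
    rw [smul_smul, smul_smul, ← pow_add, ← pow_add, hl]
  refine ⟨i, l, m, τ, hτ, ?_⟩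
  ext w
  rw [mem_scaledPrimitive]
  constructor
  · intro hw
    obtain ⟨v, hv, h⟩ := h01 w hw
    rw [hτ, mem_scaledPrimitive] at hv
    obtain ⟨w', hw', rfl⟩ := hv
    rw [← hscale] at h
    exact ⟨w', hw', smul_right_injective _ (hpow _) h⟩
  · rintro ⟨w', hw', rfl⟩
    obtain ⟨w, hw, h⟩ := h10 _ (hτ ▸ mem_scaledPrimitive.2 ⟨w', hw', rfl⟩)
    rw [← hscale] at h
    rwa [← smul_right_injective _ (hpow _) h]

namespace Heis

variable {p : ℕ} [Fact p.Prime]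

/-- The vector `(a0, b0)`. -/
def vec₀ {A : Type*} (X : Heis A) : A × A := (X.a0, X.b0)

/-- The vector `(a1, b1)`. -/
def vec₁ {A : Type*} (X : Heis A) : A × A := (X.a1, X.b1)

/-- The pair of components `(c0, c1)` of the commutator of two elements. -/
def comm₂ {A : Type*} [CommRing A] (X Y : Heis A) : A × A :=
  (det₂ X.vec₀ Y.vec₀, det₂ X.vec₀ Y.vec₁ + det₂ X.vec₁ Y.vec₀)

theorem comm₂_eq_of_mul_eq {A : Type*} [CommRing A] {X Y Z : Heis A} (h : X * Y = Y * X * Z) :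
    Z.vec₀ = 0 ∧ Z.vec₁ = 0 ∧ (Z.c0, Z.c1) = comm₂ X Y := by
  have h0 := congrArg a0 h
  have h1 := congrArg a1 h
  have h2 := congrArg b0 h
  have h3 := congrArg b1 h
  have h4 := congrArg c0 h
  have h5 := congrArg c1 h
  simp only [mul_a0, mul_a1, mul_b0, mul_b1, mul_c0, mul_c1] at h0 h1 h2 h3 h4 h5
  have e0 : Z.a0 = 0 := by linear_combination -h0
  have e1 : Z.a1 = 0 := by linear_combination -h1
  have e2 : Z.b0 = 0 := by linear_combination -h2
  have e3 : Z.b1 = 0 := by linear_combination -h3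
  refine ⟨Prod.ext e0 e2, Prod.ext e1 e3, Prod.ext ?_ ?_⟩
  · simp only [comm₂, det₂, vec₀]
    rw [e2] at h4
    linear_combination -h4
  · simp only [comm₂, det₂, vec₀, vec₁]
    rw [e2, e3] at h5
    linear_combination -h5

theorem comm₂_eq_zero_of_commute {A : Type*} [CommRing A] {X Y : Heis A} (h : Commute X Y) :
    comm₂ X Y = 0 := by
  rw [← (comm₂_eq_of_mul_eq (Z := 1) (by rw [mul_one, h.eq])).2.2]
  rfl

/-- Four elements of the `p`-adic Heisenberg group that satisfy the relations of the generators of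
the Heisenberg group and topologically generate the closure of a subgroup of the integral
Heisenberg group. -/
structure IsPadicFrame (D : Subgroup (Heis ℤ)) (X₁ X₂ Y₁ Y₂ : Heis ℤ_[p]) : Prop where
  xx : comm₂ X₁ X₂ = 0
  yy : comm₂ Y₁ Y₂ = 0
  x₂y₁ : comm₂ X₂ Y₁ = 0
  xy : comm₂ X₁ Y₁ = comm₂ X₂ Y₂
  approx₁ : ∀ n, ∃ g ∈ D, Congruent n X₁ (padic p g)
  approx₂ : ∀ n, ∃ g ∈ D, Congruent n X₂ (padic p g)
  approx₃ : ∀ n, ∃ g ∈ D, Congruent n Y₁ (padic p g)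
  approx₄ : ∀ n, ∃ g ∈ D, Congruent n Y₂ (padic p g)
  coords : ∀ g ∈ D, ∃ r₁ r₂ s₁ s₂ t₁ t₂ : ℤ_[p],
    (padic p g).vec₀ = r₁ • X₁.vec₀ + r₂ • X₂.vec₀ + s₁ • Y₁.vec₀ + s₂ • Y₂.vec₀ ∧
    (padic p g).vec₁ = r₁ • X₁.vec₁ + r₂ • X₂.vec₁ + s₁ • Y₁.vec₁ + s₂ • Y₂.vec₁ ∧
    (r₁ = 0 → r₂ = 0 → s₁ = 0 → s₂ = 0 →
      ((padic p g).c0, (padic p g).c1) = t₁ • comm₂ X₁ Y₁ + t₂ • comm₂ X₁ Y₂)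

theorem exists_isPadicFrame {D : Subgroup (Heis ℤ)} (τ : Heis ℤ →* Heis ℤ_[p])
    (hτ : closure (Set.range τ) = closure (padic p '' D)) :
    ∃ X₁ X₂ Y₁ Y₂ : Heis ℤ_[p], IsPadicFrame D X₁ X₂ Y₁ Y₂ := by
  have hrel := relations_generators (A := ℤ)
  have hmem (g : Heis ℤ) : τ g ∈ closure (padic p '' D) := hτ ▸ subset_closure ⟨g, rfl⟩
  have hE : τ (x₁ ℤ) * τ (y₁ ℤ) = τ (y₁ ℤ) * τ (x₁ ℤ) * τ (e ℤ) := by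
    simp only [← map_mul, hrel.x₁y₁]
  have hE' : τ (x₂ ℤ) * τ (y₂ ℤ) = τ (y₂ ℤ) * τ (x₂ ℤ) * τ (e ℤ) := by
    simp only [← map_mul, hrel.x₂y₂]
  have hF : τ (x₁ ℤ) * τ (y₂ ℤ) = τ (y₂ ℤ) * τ (x₁ ℤ) * τ (f ℤ) := by
    simp only [← map_mul, hrel.x₁y₂]
  have hE := comm₂_eq_of_mul_eq hE
  have hE' := comm₂_eq_of_mul_eq hE'
  have hF := comm₂_eq_of_mul_eq hF
  refine ⟨τ (x₁ ℤ), τ (x₂ ℤ), τ (y₁ ℤ), τ (y₂ ℤ), comm₂_eq_zero_of_commute (hrel.xx.map τ),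
    comm₂_eq_zero_of_commute (hrel.yy.map τ), comm₂_eq_zero_of_commute (hrel.x₂y₁.map τ),
    hE.2.2.symm.trans hE'.2.2, exists_congruent (hmem _), exists_congruent (hmem _),
    exists_congruent (hmem _), exists_congruent (hmem _), fun g hg => ?_⟩
  obtain ⟨n, q, hnq, h⟩ := exists_formalPow_of_mem_closure τ
    (hτ ▸ subset_closure ⟨g, hg, rfl⟩ : padic p g ∈ closure (Set.range τ))
  obtain ⟨hF0, hF1, hF2⟩ := hF
  obtain ⟨hE0, hE1, hE2⟩ := hE
  simp only [vec₀, vec₁, Prod.mk_eq_zero] at hF0 hF1 hE0 hE1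
  -- The exponents are numbered in the order `y₂, y₁, x₁, x₂, f, e` of the normal form.
  refine ⟨n 2, n 3, n 1, n 0, n 5, n 4, ?_, ?_, ?_⟩
  · rw [h]
    ext <;> simp [vec₀, formalPow, hF0, hE0] <;> ring
  · rw [h]
    ext <;> simp [vec₁, formalPow, hF1, hE1] <;> ring
  · intro h2 h3 h1 h0
    -- A vanishing exponent forces `2 * q i = 0`, and `2` is not a zero divisor in `ℤ_[p]`.
    have hq (i : Fin 6) (hi : n i = 0) : q i = 0 := by
      have := hnq i
      rw [hi, zero_mul] at this
      exact (mul_eq_zero.1 this).resolve_left two_ne_zero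
    rw [h, ← hE2, ← hF2]
    simp [formalPow, h0, h1, h2, h3, hq 0 h0, hq 1 h1, hq 2 h2, hq 3 h3, hF0, hE0, hF1, hE1]
    constructor <;> ring

/-- The lattice of the vectors `(a0, b0)` of the elements of a subgroup. -/
def lattice₁ (D : Subgroup (Heis ℤ)) : AddSubgroup (ℤ × ℤ) :=
  AddSubgroup.toSubgroup.symm ((D.map proj).map (MonoidHom.fst _ _))

/-- The lattice of the vectors `(a1, b1)` of the elements of a subgroup with `a0 = b0 = 0`. -/
def lattice₀ (D : Subgroup (Heis ℤ)) : AddSubgroup (ℤ × ℤ) :=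
  AddSubgroup.toSubgroup.symm ((D.map proj).comap (MonoidHom.inr _ _))

theorem mem_lattice₁ {D : Subgroup (Heis ℤ)} {v : ℤ × ℤ} :
    v ∈ lattice₁ D ↔ ∃ g ∈ D, g.vec₀ = v := by
  constructor
  · rintro ⟨_, ⟨g, hg, rfl⟩, h⟩
    exact ⟨g, hg, h⟩
  · rintro ⟨g, hg, rfl⟩
    exact ⟨_, ⟨g, hg, rfl⟩, rfl⟩

theorem mem_lattice₀ {D : Subgroup (Heis ℤ)} {w : ℤ × ℤ} :
    w ∈ lattice₀ D ↔ ∃ g ∈ D, g.vec₀ = 0 ∧ g.vec₁ = w := by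
  constructor
  · rintro ⟨g, hg, h⟩
    exact ⟨g, hg, congrArg Prod.fst h, congrArg Prod.snd h⟩
  · rintro ⟨g, hg, h0, rfl⟩
    exact ⟨g, hg, Prod.ext h0 rfl⟩

end Heis

/-! ### Descent from the `p`-adic frame to the subgroup -/

namespace Heis

theorem mem_of_pow_dvd {p : ℕ} {D : Subgroup (Heis ℤ)} {k : ℕ} (hD : D.index = p ^ k)
    {g : Heis ℤ} (h0 : (p ^ k : ℤ) ∣ g.a0) (h1 : (p ^ k : ℤ) ∣ g.a1)
    (h2 : (p ^ k : ℤ) ∣ g.b0) (h3 : (p ^ k : ℤ) ∣ g.b1) (h4 : (p ^ k : ℤ) ∣ g.c0)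
    (h5 : (p ^ k : ℤ) ∣ g.c1) : g ∈ D := by
  have h : (D.index : ℤ) = (p : ℤ) ^ k := by rw [hD]; push_cast; rfl
  rw [← h] at h0 h1 h2 h3 h4 h5
  exact mem_of_dvd h0 h1 h2 h3 h4 h5

variable {p : ℕ} [Fact p.Prime]

theorem vec₀_padic (g : Heis ℤ) : (padic p g).vec₀ = ((g.a0 : ℤ_[p]), (g.b0 : ℤ_[p])) := rfl

theorem Congruent.exists_vec₀ {n : ℕ} {X Y : Heis ℤ_[p]} (h : Congruent n X Y) :
    ∃ z : ℤ_[p] × ℤ_[p], X.vec₀ = Y.vec₀ + (p : ℤ_[p]) ^ n • z := by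
  obtain ⟨a, ha⟩ := h.a0
  obtain ⟨b, hb⟩ := h.b0
  refine ⟨(a, b), Prod.ext ?_ ?_⟩ <;> simp [vec₀, ← ha, ← hb]

theorem Congruent.exists_vec₁ {n : ℕ} {X Y : Heis ℤ_[p]} (h : Congruent n X Y) :
    ∃ z : ℤ_[p] × ℤ_[p], X.vec₁ = Y.vec₁ + (p : ℤ_[p]) ^ n • z := by
  obtain ⟨a, ha⟩ := h.a1
  obtain ⟨b, hb⟩ := h.b1
  refine ⟨(a, b), Prod.ext ?_ ?_⟩ <;> simp [vec₁, ← ha, ← hb]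

theorem exists_int_approx (x : ℤ_[p]) (n : ℕ) :
    ∃ (a : ℤ) (y : ℤ_[p]), x = a + (p : ℤ_[p]) ^ n * y := by
  obtain ⟨y, hy⟩ := Ideal.mem_span_singleton.1 (PadicInt.appr_spec n x)
  exact ⟨x.appr n, y, by push_cast; rw [← hy]; ring⟩

theorem pow_ne_zero' (n : ℕ) : (p : ℤ_[p]) ^ n ≠ 0 :=
  pow_ne_zero _ (by exact_mod_cast (Fact.out : p.Prime).ne_zero)

theorem int_pow_dvd {n : ℕ} {a : ℤ} {z : ℤ_[p]} (h : (a : ℤ_[p]) = (p : ℤ_[p]) ^ n * z) :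
    (p ^ n : ℤ) ∣ a :=
  (PadicInt.pow_p_dvd_int_iff n a).1 ⟨z, h⟩

section

variable {D : Subgroup (Heis ℤ)} {k : ℕ} (hD : D.index = p ^ k)
include hD

/-- An error divisible by `p ^ k` can be corrected by an element that lies in `D` because of its
index. -/
theorem mem_lattice₁_of_approx {g : Heis ℤ} (hg : g ∈ D) {v : ℤ × ℤ} {z : ℤ_[p] × ℤ_[p]}
    (h : ((v.1 : ℤ_[p]), (v.2 : ℤ_[p])) = (padic p g).vec₀ + (p : ℤ_[p]) ^ k • z) :
    v ∈ lattice₁ D := by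
  have h1 : (p ^ k : ℤ) ∣ v.1 - g.a0 := int_pow_dvd (z := z.1) (by
    have := congrArg Prod.fst h
    simp [vec₀] at this
    push_cast; rw [this]; ring)
  have h2 : (p ^ k : ℤ) ∣ v.2 - g.b0 := int_pow_dvd (z := z.2) (by
    have := congrArg Prod.snd h
    simp [vec₀] at this
    push_cast; rw [this]; ring)
  have hk : (⟨v.1 - g.a0, 0, v.2 - g.b0, 0, 0, 0⟩ : Heis ℤ) ∈ D := by
    apply mem_of_pow_dvd hD <;> first | exact h1 | exact h2 | exact dvd_zero _
  refine mem_lattice₁.2 ⟨_, D.mul_mem hg hk, ?_⟩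
  ext <;> simp [vec₀]

theorem mem_lattice₀_of_approx {g : Heis ℤ} (hg : g ∈ D) {w : ℤ × ℤ} {z z' : ℤ_[p] × ℤ_[p]}
    (h : 0 = (padic p g).vec₀ + (p : ℤ_[p]) ^ k • z)
    (h' : ((w.1 : ℤ_[p]), (w.2 : ℤ_[p])) = (padic p g).vec₁ + (p : ℤ_[p]) ^ k • z') :
    w ∈ lattice₀ D := by
  have h1 : (p ^ k : ℤ) ∣ -g.a0 := int_pow_dvd (z := z.1) (by
    have := congrArg Prod.fst h
    simp [vec₀] at this
    push_cast; linear_combination this)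
  have h2 : (p ^ k : ℤ) ∣ -g.b0 := int_pow_dvd (z := z.2) (by
    have := congrArg Prod.snd h
    simp [vec₀] at this
    push_cast; linear_combination this)
  have h3 : (p ^ k : ℤ) ∣ w.1 - g.a1 := int_pow_dvd (z := z'.1) (by
    have := congrArg Prod.fst h'
    simp [vec₁] at this
    push_cast; rw [this]; ring)
  have h4 : (p ^ k : ℤ) ∣ w.2 - g.b1 := int_pow_dvd (z := z'.2) (by
    have := congrArg Prod.snd h'
    simp [vec₁] at this
    push_cast; rw [this]; ring)
  have hk : (⟨-g.a0, w.1 - g.a1, -g.b0, w.2 - g.b1, 0, 0⟩ : Heis ℤ) ∈ D := by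
    apply mem_of_pow_dvd hD <;>
      first | exact h1 | exact h2 | exact h3 | exact h4 | exact dvd_zero _
  refine mem_lattice₀.2 ⟨_, D.mul_mem hg hk, ?_, ?_⟩
  · ext <;> simp [vec₀]
  · ext <;> simp [vec₁]

/-- `D` contains the elements with a single coordinate `a0`, `b0` or `b1` equal to `p ^ k`; their
commutators already give `p ^ (2 * k)` times both generators of the centre. -/
theorem mem_comap_center_of_approx {w : ℤ × ℤ} {z : ℤ_[p] × ℤ_[p]}
    (h : ((w.1 : ℤ_[p]), (w.2 : ℤ_[p])) = (p : ℤ_[p]) ^ (2 * k) • z) :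
    Multiplicative.ofAdd w ∈ derived (D.map proj) := by
  obtain ⟨a, ha⟩ := int_pow_dvd (z := z.1) (n := 2 * k) (a := w.1) (congrArg Prod.fst h)
  obtain ⟨b, hb⟩ := int_pow_dvd (z := z.2) (n := 2 * k) (a := w.2) (congrArg Prod.snd h)
  have key (g g' : Heis ℤ) (hg : g ∈ D) (hg' : g' ∈ D) :
      bracket (proj g) (proj g') ∈ derived (D.map proj) :=
    Subgroup.subset_closure ⟨_, Subgroup.mem_map_of_mem _ hg, _, Subgroup.mem_map_of_mem _ hg', rfl⟩
  have h1 : (⟨p ^ k, 0, 0, 0, 0, 0⟩ : Heis ℤ) ∈ D := by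
    apply mem_of_pow_dvd hD <;> simp
  have h2 : (⟨0, 0, p ^ k, 0, 0, 0⟩ : Heis ℤ) ∈ D := by
    apply mem_of_pow_dvd hD <;> simp
  have h3 : (⟨0, 0, 0, p ^ k, 0, 0⟩ : Heis ℤ) ∈ D := by
    apply mem_of_pow_dvd hD <;> simp
  convert Subgroup.mul_mem _ (Subgroup.zpow_mem _ (key _ _ h1 h2) a)
    (Subgroup.zpow_mem _ (key _ _ h1 h3) b) using 1
  refine congrArg Multiplicative.ofAdd (Prod.ext ?_ ?_)
  · simp [bracket, proj_apply, det₂, ha, pow_mul]; ring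
  · simp [bracket, proj_apply, det₂, hb, pow_mul]; ring

namespace IsPadicFrame

variable {X₁ X₂ Y₁ Y₂ : Heis ℤ_[p]} (h : IsPadicFrame D X₁ X₂ Y₁ Y₂)
include h

/-- If the determinants of `X₁` with `Y₁` and `Y₂` both vanished, so would all six determinants of
the constant parts. The vectors `(a0, b0)` of `D` would then have rank at most one, but `D` contains
`p ^ k` times both unit vectors. -/
theorem vec₀_eq_zero : X₂.vec₀ = 0 ∧ Y₁.vec₀ = 0 := by
  have h12 : det₂ X₁.vec₀ X₂.vec₀ = 0 := congrArg Prod.fst h.xx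
  have h34 : det₂ Y₁.vec₀ Y₂.vec₀ = 0 := congrArg Prod.fst h.yy
  have h23 : det₂ X₂.vec₀ Y₁.vec₀ = 0 := congrArg Prod.fst h.x₂y₁
  have h13 : det₂ X₁.vec₀ Y₁.vec₀ = det₂ X₂.vec₀ Y₂.vec₀ := congrArg Prod.fst h.xy
  refine eq_zero_and_eq_zero_of_det h12 h34 h23 h13 fun ⟨h1, h2⟩ => ?_
  have h24 : det₂ X₂.vec₀ Y₂.vec₀ = 0 := h13 ▸ h1
  have m1 : (⟨p ^ k, 0, 0, 0, 0, 0⟩ : Heis ℤ) ∈ D := by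
    apply mem_of_pow_dvd hD <;> simp
  have m2 : (⟨0, 0, p ^ k, 0, 0, 0⟩ : Heis ℤ) ∈ D := by
    apply mem_of_pow_dvd hD <;> simp
  obtain ⟨r₁, r₂, s₁, s₂, -, -, e, -⟩ := h.coords _ m1
  obtain ⟨r₁', r₂', s₁', s₂', -, -, e', -⟩ := h.coords _ m2
  have hdet : det₂ (padic p ⟨p ^ k, 0, 0, 0, 0, 0⟩).vec₀ (padic p ⟨0, 0, p ^ k, 0, 0, 0⟩).vec₀ =
      (p : ℤ_[p]) ^ (k + k) := by
    simp [vec₀, det₂, pow_add]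
  refine pow_ne_zero' (p := p) (k + k) ?_
  rw [← hdet, e, e']
  simp only [det₂, Prod.fst_add, Prod.snd_add, Prod.smul_fst, Prod.smul_snd, smul_eq_mul]
    at h12 h34 h23 h1 h2 h24 ⊢
  linear_combination (r₁ * r₂' - r₂ * r₁') * h12 + (s₁ * s₂' - s₂ * s₁') * h34 +
    (r₂ * s₁' - s₁ * r₂') * h23 + (r₁ * s₁' - s₁ * r₁') * h1 + (r₁ * s₂' - s₂ * r₁') * h2 +
    (r₂ * s₂' - s₂ * r₂') * h24

theorem coords₀ {g : Heis ℤ} (hg : g ∈ D) : ∃ r s : ℤ_[p],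
    (padic p g).vec₀ = r • X₁.vec₀ + s • Y₂.vec₀ := by
  obtain ⟨r₁, r₂, s₁, s₂, -, -, e, -⟩ := h.coords _ hg
  obtain ⟨hX, hY⟩ := h.vec₀_eq_zero hD
  exact ⟨r₁, s₂, by rw [e, hX, hY]; simp⟩

theorem det_ne_zero : det₂ X₁.vec₀ Y₂.vec₀ ≠ 0 := by
  intro h0
  have m1 : (⟨p ^ k, 0, 0, 0, 0, 0⟩ : Heis ℤ) ∈ D := by
    apply mem_of_pow_dvd hD <;> simp
  have m2 : (⟨0, 0, p ^ k, 0, 0, 0⟩ : Heis ℤ) ∈ D := by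
    apply mem_of_pow_dvd hD <;> simp
  obtain ⟨r, s, e⟩ := h.coords₀ hD m1
  obtain ⟨r', s', e'⟩ := h.coords₀ hD m2
  have hdet : det₂ (padic p ⟨p ^ k, 0, 0, 0, 0, 0⟩).vec₀ (padic p ⟨0, 0, p ^ k, 0, 0, 0⟩).vec₀ =
      (p : ℤ_[p]) ^ (k + k) := by
    simp [vec₀, det₂, pow_add]
  refine pow_ne_zero' (p := p) (k + k) ?_
  rw [← hdet, e, e']
  simp only [det₂, Prod.fst_add, Prod.snd_add, Prod.smul_fst, Prod.smul_snd, smul_eq_mul] at h0 ⊢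
  linear_combination (r * s' - s * r') * h0

theorem eq_zero_of_vec₀ {r s : ℤ_[p]} (h0 : r • X₁.vec₀ + s • Y₂.vec₀ = 0) : r = 0 ∧ s = 0 :=
  eq_zero_of_smul_add_smul_eq_zero (h.det_ne_zero hD) h0

theorem coords₁ {g : Heis ℤ} (hg : g ∈ D) (hg0 : g.vec₀ = 0) : ∃ r s t₁ t₂ : ℤ_[p],
    (padic p g).vec₁ = r • X₂.vec₁ + s • Y₁.vec₁ ∧ (r = 0 → s = 0 →
      ((padic p g).c0, (padic p g).c1) = t₁ • comm₂ X₁ Y₁ + t₂ • comm₂ X₁ Y₂) := by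
  obtain ⟨r₁, r₂, s₁, s₂, t₁, t₂, e, e', e''⟩ := h.coords _ hg
  obtain ⟨hX, hY⟩ := h.vec₀_eq_zero hD
  have hz : (padic p g).vec₀ = 0 := by
    simp only [vec₀, Prod.mk_eq_zero] at hg0
    rw [vec₀_padic, hg0.1, hg0.2]
    simp
  rw [hz, hX, hY, smul_zero, smul_zero, add_zero, add_zero] at e
  obtain ⟨rfl, rfl⟩ := h.eq_zero_of_vec₀ hD e.symm
  exact ⟨r₂, s₁, t₁, t₂, by rw [e']; simp, fun hr hs => e'' rfl hr hs rfl⟩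

/-- The relations make `X₂.vec₁` parallel to `X₁.vec₀`, and comparing the two commutators equal to
the image of `e` yields the same factor as in `smul_Y₁`. The equality of these factors is what makes
the two lattices proportional. -/
theorem smul_X₂ : det₂ X₁.vec₀ Y₂.vec₀ • X₂.vec₁ = det₂ X₁.vec₀ Y₁.vec₁ • X₁.vec₀ := by
  obtain ⟨hX, hY⟩ := h.vec₀_eq_zero hD
  have h1 : det₂ X₁.vec₀ X₂.vec₁ = 0 := by
    have := congrArg Prod.snd h.xx
    simpa [comm₂, hX, det₂] using this
  have h2 : det₂ X₁.vec₀ Y₁.vec₁ = det₂ X₂.vec₁ Y₂.vec₀ := by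
    have := congrArg Prod.snd h.xy
    simpa [comm₂, hX, hY, det₂] using this
  rw [det₂_smul_eq X₁.vec₀ X₂.vec₁ Y₂.vec₀, h1, h2, zero_smul, zero_add]

theorem smul_Y₁ : det₂ X₁.vec₀ Y₂.vec₀ • Y₁.vec₁ = det₂ X₁.vec₀ Y₁.vec₁ • Y₂.vec₀ := by
  obtain ⟨hX, hY⟩ := h.vec₀_eq_zero hD
  have h1 : det₂ Y₁.vec₁ Y₂.vec₀ = 0 := by
    have := congrArg Prod.snd h.yy
    simpa [comm₂, hY, det₂] using this
  rw [det₂_smul_eq X₁.vec₀ Y₁.vec₁ Y₂.vec₀, h1, zero_smul, add_zero]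

/-- Otherwise the `ε`-layer of `D` would vanish, although it contains `p ^ k` times a unit vector.
-/
theorem det_ne_zero' : det₂ X₁.vec₀ Y₁.vec₁ ≠ 0 := by
  intro h0
  have hX := h.smul_X₂ hD
  have hY := h.smul_Y₁ hD
  rw [h0, zero_smul] at hX hY
  have hX' := (smul_eq_zero.1 hX).resolve_left (h.det_ne_zero hD)
  have hY' := (smul_eq_zero.1 hY).resolve_left (h.det_ne_zero hD)
  have m1 : (⟨0, p ^ k, 0, 0, 0, 0⟩ : Heis ℤ) ∈ D := by
    apply mem_of_pow_dvd hD <;> simp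
  obtain ⟨r, s, -, -, e, -⟩ := h.coords₁ hD m1 rfl
  rw [hX', hY', smul_zero, smul_zero, add_zero] at e
  refine pow_ne_zero' (p := p) k ?_
  simpa [vec₁] using congrArg Prod.fst e

theorem eq_zero_of_vec₁ {r s : ℤ_[p]} (h0 : r • X₂.vec₁ + s • Y₁.vec₁ = 0) : r = 0 ∧ s = 0 := by
  have h1 : (det₂ X₁.vec₀ Y₁.vec₁ * r) • X₁.vec₀ + (det₂ X₁.vec₀ Y₁.vec₁ * s) • Y₂.vec₀ = 0 := by
    rw [mul_comm _ r, mul_comm _ s, mul_smul, mul_smul, ← h.smul_X₂ hD, ← h.smul_Y₁ hD,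
      smul_comm r, smul_comm s, ← smul_add, h0, smul_zero]
  obtain ⟨hr, hs⟩ := h.eq_zero_of_vec₀ hD h1
  exact ⟨(mul_eq_zero.1 hr).resolve_left (h.det_ne_zero' hD),
    (mul_eq_zero.1 hs).resolve_left (h.det_ne_zero' hD)⟩

/-- The lattice consists of the integral points of the `ℤ_[p]`-span of `X₁` and `Y₂`: integer
approximations modulo `p ^ k` of the coefficients and of the frame suffice. -/
theorem mem_lattice₁_iff {v : ℤ × ℤ} : v ∈ lattice₁ D ↔
    ∃ r s : ℤ_[p], ((v.1 : ℤ_[p]), (v.2 : ℤ_[p])) = r • X₁.vec₀ + s • Y₂.vec₀ := by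
  constructor
  · intro hv
    obtain ⟨g, hg, rfl⟩ := mem_lattice₁.1 hv
    exact h.coords₀ hD hg
  · rintro ⟨r, s, e⟩
    obtain ⟨g, hg, hgX⟩ := h.approx₁ k
    obtain ⟨g', hg', hgY⟩ := h.approx₄ k
    obtain ⟨z, hz⟩ := hgX.exists_vec₀
    obtain ⟨z', hz'⟩ := hgY.exists_vec₀
    obtain ⟨a, y, rfl⟩ := exists_int_approx r k
    obtain ⟨b, y', rfl⟩ := exists_int_approx s k
    refine mem_lattice₁_of_approx hD (D.mul_mem (D.zpow_mem hg a) (D.zpow_mem hg' b))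
      (z := y • X₁.vec₀ + y' • Y₂.vec₀ + (a : ℤ_[p]) • z + (b : ℤ_[p]) • z') ?_
    have hm : (padic p (g ^ a * g' ^ b)).vec₀ =
        (a : ℤ_[p]) • (padic p g).vec₀ + (b : ℤ_[p]) • (padic p g').vec₀ := by
      ext <;> simp [vec₀]
    rw [hm, e, add_smul, add_smul, mul_smul, mul_smul]
    nth_rewrite 1 [hz, hz']
    module

theorem mem_lattice₀_iff {w : ℤ × ℤ} : w ∈ lattice₀ D ↔
    ∃ r s : ℤ_[p], ((w.1 : ℤ_[p]), (w.2 : ℤ_[p])) = r • X₂.vec₁ + s • Y₁.vec₁ := by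
  constructor
  · intro hw
    obtain ⟨g, hg, hg0, rfl⟩ := mem_lattice₀.1 hw
    obtain ⟨r, s, -, -, e, -⟩ := h.coords₁ hD hg hg0
    exact ⟨r, s, e⟩
  · rintro ⟨r, s, e⟩
    obtain ⟨hX, hY⟩ := h.vec₀_eq_zero hD
    obtain ⟨g, hg, hgX⟩ := h.approx₂ k
    obtain ⟨g', hg', hgY⟩ := h.approx₃ k
    obtain ⟨z, hz⟩ := hgX.exists_vec₁
    obtain ⟨z', hz'⟩ := hgY.exists_vec₁
    obtain ⟨z₀, hz₀⟩ := hgX.exists_vec₀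
    obtain ⟨z₀', hz₀'⟩ := hgY.exists_vec₀
    obtain ⟨a, y, rfl⟩ := exists_int_approx r k
    obtain ⟨b, y', rfl⟩ := exists_int_approx s k
    refine mem_lattice₀_of_approx hD (D.mul_mem (D.zpow_mem hg a) (D.zpow_mem hg' b))
      (z := (a : ℤ_[p]) • z₀ + (b : ℤ_[p]) • z₀')
      (z' := y • X₂.vec₁ + y' • Y₁.vec₁ + (a : ℤ_[p]) • z + (b : ℤ_[p]) • z') ?_ ?_
    · have hm : (padic p (g ^ a * g' ^ b)).vec₀ =
          (a : ℤ_[p]) • (padic p g).vec₀ + (b : ℤ_[p]) • (padic p g').vec₀ := by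
        ext <;> simp [vec₀]
      rw [hX] at hz₀
      rw [hY] at hz₀'
      have h1 := congrArg ((a : ℤ_[p]) • ·) hz₀
      have h2 := congrArg ((b : ℤ_[p]) • ·) hz₀'
      simp only [smul_zero] at h1 h2
      rw [hm, ← add_zero (0 : ℤ_[p] × ℤ_[p])]
      nth_rewrite 1 [h1]
      rw [h2]
      module
    · have hm : (padic p (g ^ a * g' ^ b)).vec₁ =
          (a : ℤ_[p]) • (padic p g).vec₁ + (b : ℤ_[p]) • (padic p g').vec₁ := by
        ext <;> simp [vec₁]
      rw [hm, e, add_smul, add_smul, mul_smul, mul_smul]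
      nth_rewrite 1 [hz, hz']
      module

end IsPadicFrame

end

theorem comm₂_padic (g g' : Heis ℤ) : comm₂ (padic p g) (padic p g') =
    (((bracket (proj g) (proj g')).toAdd.1 : ℤ_[p]),
      ((bracket (proj g) (proj g')).toAdd.2 : ℤ_[p])) := by
  simp [comm₂, vec₀, vec₁, bracket, proj_apply, det₂]

theorem Congruent.exists_comm₂ {n : ℕ} {X X' Y Y' : Heis ℤ_[p]} (h : Congruent n X Y)
    (h' : Congruent n X' Y') :
    ∃ z : ℤ_[p] × ℤ_[p], comm₂ X X' = comm₂ Y Y' + (p : ℤ_[p]) ^ n • z := by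
  obtain ⟨u, hu⟩ := h.exists_vec₀
  obtain ⟨v, hv⟩ := h.exists_vec₁
  obtain ⟨u', hu'⟩ := h'.exists_vec₀
  obtain ⟨v', hv'⟩ := h'.exists_vec₁
  refine ⟨(det₂ u Y'.vec₀ + det₂ Y.vec₀ u' + (p : ℤ_[p]) ^ n * det₂ u u',
    det₂ u Y'.vec₁ + det₂ Y.vec₀ v' + (p : ℤ_[p]) ^ n * det₂ u v' +
    (det₂ v Y'.vec₀ + det₂ Y.vec₁ u' + (p : ℤ_[p]) ^ n * det₂ v u')), ?_⟩
  rw [comm₂, comm₂, hu, hv, hu', hv']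
  ext <;> simp [det₂] <;> ring

/-- A central element of `D` is a `p`-adic combination of the two frame commutators. Coefficients
and frame are approximated modulo `p ^ (2 * k)`, the precision at which the error is itself a
product of commutators of `D`. -/
theorem IsPadicFrame.comap_center_eq {D : Subgroup (Heis ℤ)} {k : ℕ} (hD : D.index = p ^ k)
    {X₁ X₂ Y₁ Y₂ : Heis ℤ_[p]} (h : IsPadicFrame D X₁ X₂ Y₁ Y₂) :
    D.comap Heis.center = derived (D.map proj) := by
  refine le_antisymm (fun t ht => ?_) (derived_map_proj_le D)
  obtain ⟨r, s, t₁, t₂, e, e'⟩ := h.coords₁ hD ht rfl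
  have hz : (padic p (Heis.center t)).vec₁ = 0 := by simp [vec₁, center_apply]
  rw [hz] at e
  obtain ⟨hr, hs⟩ := h.eq_zero_of_vec₁ hD e.symm
  replace e' := e' hr hs
  obtain ⟨g₁, hg₁, c₁⟩ := h.approx₁ (2 * k)
  obtain ⟨g₃, hg₃, c₃⟩ := h.approx₃ (2 * k)
  obtain ⟨g₄, hg₄, c₄⟩ := h.approx₄ (2 * k)
  obtain ⟨z, hz⟩ := c₁.exists_comm₂ c₃
  obtain ⟨z', hz'⟩ := c₁.exists_comm₂ c₄
  obtain ⟨a, y, rfl⟩ := exists_int_approx t₁ (2 * k)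
  obtain ⟨b, y', rfl⟩ := exists_int_approx t₂ (2 * k)
  have key (g g' : Heis ℤ) (hg : g ∈ D) (hg' : g' ∈ D) :
      bracket (proj g) (proj g') ∈ derived (D.map proj) :=
    Subgroup.subset_closure ⟨_, Subgroup.mem_map_of_mem _ hg, _, Subgroup.mem_map_of_mem _ hg', rfl⟩
  set B := bracket (proj g₁) (proj g₃) with hB
  set B' := bracket (proj g₁) (proj g₄) with hB'
  have hw := mem_comap_center_of_approx hD
    (w := t.toAdd - a • B.toAdd - b • B'.toAdd)
    (z := y • comm₂ X₁ Y₁ + y' • comm₂ X₁ Y₂ + (a : ℤ_[p]) • z + (b : ℤ_[p]) • z') (by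
      have e1 : ((t.toAdd.1 : ℤ_[p]), (t.toAdd.2 : ℤ_[p])) =
          ((padic p (Heis.center t)).c0, (padic p (Heis.center t)).c1) := rfl
      have e2 : (((t.toAdd - a • B.toAdd - b • B'.toAdd).1 : ℤ_[p]),
          ((t.toAdd - a • B.toAdd - b • B'.toAdd).2 : ℤ_[p])) =
          ((t.toAdd.1 : ℤ_[p]), (t.toAdd.2 : ℤ_[p])) -
            (a : ℤ_[p]) • ((B.toAdd.1 : ℤ_[p]), (B.toAdd.2 : ℤ_[p])) -
            (b : ℤ_[p]) • ((B'.toAdd.1 : ℤ_[p]), (B'.toAdd.2 : ℤ_[p])) := by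
        ext <;> simp
      rw [e2, e1, e', hB, hB', ← comm₂_padic, ← comm₂_padic, add_smul, add_smul, mul_smul, mul_smul]
      nth_rewrite 1 [hz, hz']
      module)
  convert Subgroup.mul_mem _ (Subgroup.mul_mem _ hw (Subgroup.zpow_mem _ (key _ _ hg₁ hg₃) a))
    (Subgroup.zpow_mem _ (key _ _ hg₁ hg₄) b) using 1
  rw [← hB, ← hB']
  apply Multiplicative.toAdd.injective
  simp only [toAdd_mul, toAdd_zpow, toAdd_ofAdd]
  abel

theorem IsPadicFrame.exists_isProportional {D : Subgroup (Heis ℤ)} {k : ℕ}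
    (hD : D.index = p ^ k) {X₁ X₂ Y₁ Y₂ : Heis ℤ_[p]} (h : IsPadicFrame D X₁ X₂ Y₁ Y₂) :
    ∃ (i l m : ℕ) (τ : PrimitiveIndex p m), IsProportional p i l τ D := by
  have hp : p.Prime := Fact.out
  set d := det₂ X₁.vec₀ Y₂.vec₀ with hd
  set d' := det₂ X₁.vec₀ Y₁.vec₁ with hd'
  have hX := h.smul_X₂ hD
  have hY := h.smul_Y₁ hD
  rw [← hd, ← hd'] at hX hY
  have hd0 : d ≠ 0 := h.det_ne_zero hD
  have hd0' : d' ≠ 0 := h.det_ne_zero' hD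
  have ed := PadicInt.unitCoeff_spec hd0
  have ed' := PadicInt.unitCoeff_spec hd0'
  generalize PadicInt.unitCoeff hd0 = ε at ed
  generalize PadicInt.unitCoeff hd0' = ε' at ed'
  generalize d.valuation = x at ed
  generalize d'.valuation = y at ed'
  rw [ed, ed'] at hX hY
  -- Writing both determinants as a unit times a power of `p`, the proportionality factor becomes a
  -- power of `p` up to the single unit `ε⁻¹ * ε'`, which does not change spans.
  have hX' : (p : ℤ_[p]) ^ x • X₂.vec₁ =
      (p : ℤ_[p]) ^ y • (((ε⁻¹ * ε' : ℤ_[p]ˣ) : ℤ_[p]) • X₁.vec₀) := by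
    have := congrArg (((ε⁻¹ : ℤ_[p]ˣ) : ℤ_[p]) • ·) hX
    simp only [smul_smul, ← mul_assoc, Units.inv_mul, one_mul] at this
    rw [this, smul_smul, Units.val_mul]
    congr 1; ring
  have hY' : (p : ℤ_[p]) ^ x • Y₁.vec₁ =
      (p : ℤ_[p]) ^ y • (((ε⁻¹ * ε' : ℤ_[p]ˣ) : ℤ_[p]) • Y₂.vec₀) := by
    have := congrArg (((ε⁻¹ : ℤ_[p]ˣ) : ℤ_[p]) • ·) hY
    simp only [smul_smul, ← mul_assoc, Units.inv_mul, one_mul] at this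
    rw [this, smul_smul, Units.val_mul]
    congr 1; ring
  generalize ε⁻¹ * ε' = u at hX' hY'
  have divide {n : ℕ} {v : ℤ × ℤ} {z : ℤ_[p] × ℤ_[p]}
      (e : ((v.1 : ℤ_[p]), (v.2 : ℤ_[p])) = (p : ℤ_[p]) ^ n • z) :
      ∃ w : ℤ × ℤ, v = (p ^ n : ℤ) • w ∧ ((w.1 : ℤ_[p]), (w.2 : ℤ_[p])) = z := by
    obtain ⟨a, ha⟩ := int_pow_dvd (z := z.1) (n := n) (a := v.1) (congrArg Prod.fst e)
    obtain ⟨b, hb⟩ := int_pow_dvd (z := z.2) (n := n) (a := v.2) (congrArg Prod.snd e)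
    refine ⟨(a, b), Prod.ext ha hb, ?_⟩
    apply smul_right_injective _ (pow_ne_zero' (p := p) n)
    dsimp only
    rw [← e, ha, hb]
    ext <;> simp
  have cast_smul (n : ℕ) (w : ℤ × ℤ) :
      ((((p ^ n : ℤ) • w).1 : ℤ_[p]), (((p ^ n : ℤ) • w).2 : ℤ_[p])) =
        (p : ℤ_[p]) ^ n • ((w.1 : ℤ_[p]), (w.2 : ℤ_[p])) := by
    ext <;> simp
  obtain ⟨i, l, m, τ, h1, h0⟩ := exists_scaledPrimitive_of_smul_eq (n := k) (x := x) (y := y) hp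
    (L₁ := lattice₁ D) (L₀ := lattice₀ D) (fun w => by
      refine mem_lattice₁.2 ⟨⟨p ^ k * w.1, 0, p ^ k * w.2, 0, 0, 0⟩, ?_, rfl⟩
      apply mem_of_pow_dvd hD <;> simp) (fun w hw => by
      obtain ⟨r, s, e⟩ := (h.mem_lattice₀_iff hD).1 hw
      have e2 : ((((p ^ x : ℤ) • w).1 : ℤ_[p]), (((p ^ x : ℤ) • w).2 : ℤ_[p])) =
          (p : ℤ_[p]) ^ y • ((r * u) • X₁.vec₀ + (s * u) • Y₂.vec₀) := by
        rw [cast_smul, e, smul_add, smul_comm _ r, smul_comm _ s, hX', hY']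
        module
      obtain ⟨v, hv, hv'⟩ := divide e2
      exact ⟨v, (h.mem_lattice₁_iff hD).2 ⟨_, _, hv'⟩, hv⟩) (fun v hv => by
      obtain ⟨r, s, e⟩ := (h.mem_lattice₁_iff hD).1 hv
      have hu : ((u⁻¹ : ℤ_[p]ˣ) : ℤ_[p]) * u = 1 := u.inv_mul
      have e2 : ((((p ^ y : ℤ) • v).1 : ℤ_[p]), (((p ^ y : ℤ) • v).2 : ℤ_[p])) =
          (p : ℤ_[p]) ^ x • ((r * (u⁻¹ : ℤ_[p]ˣ)) • X₂.vec₁ + (s * (u⁻¹ : ℤ_[p]ˣ)) • Y₁.vec₁) := by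
        have inv_smul {V W : ℤ_[p] × ℤ_[p]}
            (hVW : (p : ℤ_[p]) ^ x • V = (p : ℤ_[p]) ^ y • ((u : ℤ_[p]) • W)) :
            (p : ℤ_[p]) ^ x • (((u⁻¹ : ℤ_[p]ˣ) : ℤ_[p]) • V) = (p : ℤ_[p]) ^ y • W := by
          rw [smul_comm, hVW, smul_comm, smul_smul (_ : ℤ_[p]) (u : ℤ_[p]) W, hu, one_smul]
        rw [cast_smul, e, mul_smul, mul_smul, smul_add, smul_add, smul_comm _ r, smul_comm _ s,
          ← inv_smul hX', ← inv_smul hY', smul_comm r, smul_comm s]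
      obtain ⟨w, hw, hw'⟩ := divide e2
      exact ⟨w, (h.mem_lattice₀_iff hD).2 ⟨_, _, hw'⟩, hw.symm⟩)
  refine ⟨i, l, m, τ, ?_, ?_, h.comap_center_eq hD⟩
  · rw [← h1]; simp [lattice₁]
  · rw [← h0]; simp [lattice₀]

end Heis

/-! ### Classification of the subgroups and conclusion -/

namespace Heis

/-- The subgroups of `p`-power index whose profinite completion is isomorphic to that of the
Heisenberg group are those described by pairs of proportional lattices. -/
theorem proisomorphicSubgroups_eq {p : ℕ} (hp : p.Prime) (k : ℕ) :
    proisomorphicSubgroups (Heis ℤ) (p ^ k) =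
      {D : Subgroup (Heis ℤ) | ∃ (i l m : ℕ) (τ : PrimitiveIndex p m),
        5 * i + 3 * l + 4 * m = k ∧ IsProportional p i l τ D} := by
  have : Fact p.Prime := ⟨hp⟩
  ext D
  constructor
  · rintro ⟨hD, ⟨e⟩⟩
    obtain ⟨τ, hτ⟩ := exists_monoidHom_closure_range_eq e ((padic p).comp D.subtype)
    have hr : Set.range ((padic p).comp D.subtype) = padic p '' D := by
      rw [MonoidHom.coe_comp, Set.range_comp, Subgroup.coe_subtype, Subtype.range_coe]
    rw [hr] at hτ
    obtain ⟨X₁, X₂, Y₁, Y₂, h⟩ := exists_isPadicFrame τ hτ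
    obtain ⟨i, l, m, σ, hσ⟩ := h.exists_isProportional hD
    -- The equation between the exponents comes from computing the index of `D` twice.
    exact ⟨i, l, m, σ, Nat.pow_right_injective hp.two_le ((hσ.index_eq hp).symm.trans hD), hσ⟩
  · rintro ⟨i, l, m, σ, hk, h⟩
    obtain ⟨e⟩ := h.nonempty_mulEquiv hp
    exact ⟨hk ▸ h.index_eq hp, ⟨completionCongr e⟩⟩

end Heis

theorem proisomorphicSubgroups_congr {G H : Type} [Group G] [Group H] (e : G ≃* H) (n : ℕ) :
    Subgroup.map e.toMonoidHom '' proisomorphicSubgroups G n = proisomorphicSubgroups H n := by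
  have key {G H : Type} [Group G] [Group H] (e : G ≃* H) {D : Subgroup G}
      (hD : D ∈ proisomorphicSubgroups G n) :
      D.map e.toMonoidHom ∈ proisomorphicSubgroups H n := by
    obtain ⟨h1, ⟨c⟩⟩ := hD
    exact ⟨(Subgroup.index_map_equiv D e).trans h1,
      ⟨((completionCongr (e.subgroupMap D)).symm.trans c).trans (completionCongr e)⟩⟩
  refine Set.Subset.antisymm (Set.image_subset_iff.2 fun D hD => key e hD) fun D hD => ?_
  refine ⟨_, key e.symm hD, ?_⟩
  ext x
  simp [Subgroup.mem_map]

theorem finite_proisomorphicSubgroups {n : ℕ} (hn : 0 < n) :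
    (proisomorphicSubgroups (DStarGroup 2 (X ^ 2)) n).Finite := by
  have h : (proisomorphicSubgroups (Heis ℤ) n).Finite :=
    (Heis.finite_setOf_index_eq hn).subset fun D hD => hD.1
  rw [← proisomorphicSubgroups_congr Heis.equivDStarGroup n] at h
  exact h.of_finite_image
    (Subgroup.map_injective Heis.equivDStarGroup.injective).injOn

theorem proisomorphicCount_dStarGroup {p : ℕ} (hp : p.Prime) (k : ℕ) :
    proisomorphicCount (DStarGroup 2 (X ^ 2)) (p ^ k) = Heis.count p k := by
  rw [proisomorphicCount, Heis.count, ← Heis.ncard_isProportional hp,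
    ← Heis.proisomorphicSubgroups_eq hp, ← proisomorphicSubgroups_congr Heis.equivDStarGroup]
  exact (Set.ncard_image_of_injective _ (Subgroup.map_injective
    (f := Heis.equivDStarGroup.toMonoidHom) Heis.equivDStarGroup.injective)).symm

/-- Under inversion each factor `1 - U ^ a V ^ b` of the denominator contributes `-U ^ (-a) V ^
(-b)`, while the numerator is reproduced up to `U ^ (-10) V ^ (-4)`. Hence the sign `(-1) ^ 3` and
the exponents `8 + 11 + 12 - 10 = 21` and `3 + 4 + 5 - 4 = 8`. -/
theorem proisomorphicFunctionalEquation_dStarGroup :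
    ProisomorphicFunctionalEquation (DStarGroup 2 (X ^ 2)) 1 21 8 := by
  let x : MvPolynomial (Fin 2) ℚ := MvPolynomial.X 0
  let y : MvPolynomial (Fin 2) ℚ := MvPolynomial.X 1
  refine ⟨1 + x ^ 10 * y ^ 4, (1 - x ^ 8 * y ^ 3) * (1 - x ^ 11 * y ^ 4) * (1 - x ^ 12 * y ^ 5),
    fun p hp => ⟨fun h => ?_, ?_⟩, ?_⟩
  · have := congrArg PowerSeries.constantCoeff h
    simp [x, y] at this
  · have := Heis.mul_mk_count (R := ℚ) p
    simp_rw [proisomorphicCount_dStarGroup hp]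
    simpa [x, y] using this
  · intro U V
    have hU : U ≠ 0 := by simp [U]
    have hV : V ≠ 0 := by simp [V]
    have hne (a b : ℕ) (hb : b ≠ 0) : (1 : MvPolynomial (Fin 2) ℚ) - x ^ a * y ^ b ≠ 0 := by
      intro h
      have := congrArg (MvPolynomial.aeval ![(0 : ℚ), 0]) h
      simp [x, y, hb] at this
    have hne' (a b : ℕ) (hb : b ≠ 0) : 1 - U ^ a * V ^ b ≠ 0 := by
      have := (map_ne_zero_iff _ (IsFractionRing.injective (MvPolynomial (Fin 2) ℚ)
        (FractionRing (MvPolynomial (Fin 2) ℚ)))).2 (hne a b hb)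
      simpa [U, V, x, y] using this
    have hinv (a b : ℕ) : 1 - U⁻¹ ^ a * V⁻¹ ^ b = -(1 - U ^ a * V ^ b) / (U ^ a * V ^ b) := by
      rw [inv_pow, inv_pow]
      field_simp
      ring
    have h3 := hne' 8 3 (by norm_num)
    have h4 := hne' 11 4 (by norm_num)
    have h5 := hne' 12 5 (by norm_num)
    simp only [x, y, map_mul, map_sub, map_add, map_one, map_pow, MvPolynomial.aeval_X,
      Matrix.cons_val_zero, Matrix.cons_val_one, hinv]
    generalize e3 : 1 - U ^ 8 * V ^ 3 = d3 at *
    generalize e4 : 1 - U ^ 11 * V ^ 4 = d4 at *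
    generalize e5 : 1 - U ^ 12 * V ^ 5 = d5 at *
    have h21 : U ^ (21 : ℤ) = U ^ 21 := by norm_cast
    have h8 : V ^ (8 : ℤ) = V ^ 8 := by norm_cast
    rw [h21, h8, zpow_one]
    field_simp
    ring

theorem mainTheorem1 :
    (∀ n : ℕ, 0 < n → (proisomorphicSubgroups (DStarGroup 2 (X ^ 2)) n).Finite) ∧
    (∀ p : ℕ, p.Prime → ∀ s : ℂ, 11 / 4 < s.re →
      Summable (fun k : ℕ => (proisomorphicCount (DStarGroup 2 (X ^ 2)) (p ^ k) : ℂ) *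
        (p : ℂ) ^ (-((k : ℂ) * s))) ∧
      localProisomorphicZeta (DStarGroup 2 (X ^ 2)) p s =
        (1 + (p : ℂ) ^ (10 - 4 * s)) /
          ((1 - (p : ℂ) ^ (8 - 3 * s)) * (1 - (p : ℂ) ^ (11 - 4 * s)) *
            (1 - (p : ℂ) ^ (12 - 5 * s)))) ∧
    ProisomorphicFunctionalEquation (DStarGroup 2 (X ^ 2)) 1 21 8 := by
  refine ⟨fun n hn => finite_proisomorphicSubgroups hn, fun p hp s hs => ?_,
    proisomorphicFunctionalEquation_dStarGroup⟩
  have h := (Heis.hasAbsSum_count hp hs).2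
  have hterm (k : ℕ) : PowerSeries.coeff k (PowerSeries.mk fun k => (Heis.count p k : ℂ)) *
      ((p : ℂ) ^ (-s)) ^ k =
      (proisomorphicCount (DStarGroup 2 (X ^ 2)) (p ^ k) : ℂ) * (p : ℂ) ^ (-((k : ℂ) * s)) := by
    rw [PowerSeries.coeff_mk, proisomorphicCount_dStarGroup hp, ← Complex.cpow_nat_mul, mul_neg]
  simp_rw [hterm] at h
  exact ⟨h.summable, h.tsum_eq⟩
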